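/- Let $\mathbb D=\{z\in\mathbb C:|z|<1\}$ and let $\mathcal S$ be the family of univalent analytic functions $f$ on $\mathbb D$ with $f(0)=0$ and $f'(0)=1$. Let $\phi:\mathbb D\to\mathbb C$ be analytic and univalent with $\operatorname{Re}\phi>0$ on $\mathbb D$, $\phi(0)=1$, $\phi'(0)>0$, and with $\phi(\mathbb D)$ symmetric with respect to the real axis and starlike with respect to $1$. Write $\phi(z)=1+\sum_{n\ge1}B_nz^n$ and suppose that $B_n>0$ for all $n\ge1$ and that $\phi$ is in the Hardy class $H^2$ of $\mathbb D$. Let $\mathcal C(\phi)$ be the class of all $f\in\mathcal S$ with $1+zf''(z)/f'(z)\prec\phi(z)$, where $F\prec G$ means that $F=G\circ\omega$ on $\mathbb D$ for some analytic $\omega:\mathbb D\to\mathbb D$ with $\omega(0)=0$. Then there is a function $k\in\mathcal S$ with $1+zk''(z)/k'(z)=\phi(z)$ on $\mathbb D$, and for any such $k$ the following holds. The limit $k(-1):=\lim_{r\to1^-}k(-r)$ exists and is real, and the equation $k(r)+k(-1)=0$ has a smallest root $r_f$ in $(0,1)$. For every $f(z)=z+\sum_{n\ge2}a_nz^n$ in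 $\mathcal C(\phi)$ the series $\sum_{n\ge 2}|a_n||z|^n$ converges for $|z|<1$, and $$M_f(|z|):=|z|+\sum_{n=2}^{\infty}|a_n||z|^n\le d\bigl(f(0),\partial f(\mathbb D)\bigr)\qquad\text{for } |z|\le\min\{r_f,1/3\},$$ where $d$ is the Euclidean distance. If $r_f\le 1/3$, then the radius $r_f$ is best possible: each rotation $k_\theta(z)=e^{-i\theta}k(e^{i\theta}z)$, $\theta\in\mathbb R$, belongs to $\mathcal C(\phi)$ and satisfies $M_{k_\theta}(r_f)=d(k_\theta(0),\partial k_\theta(\mathbb D))=-k(-1)$, while $M_{k_\theta}(r)>d(k_\theta(0),\partial k_\theta(\mathbb D))$ for $r_f<r<1$. -/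

import Mathlib

open Set Filter Topology

namespace MaMinda

noncomputable section

/-- The open unit disk of the complex plane. Functions on the disk are represented by
functions `ℂ → ℂ` of which only the values on the disk are used. -/
def disk : Set ℂ := Metric.ball (0 : ℂ) 1

/-- The `n`-th Taylor coefficient at the origin, `a_n = f⁽ⁿ⁾(0) / n!`. -/
def coeff (f : ℂ → ℂ) (n : ℕ) : ℂ := iteratedDeriv n f 0 / (n.factorial : ℂ)

/-- The family `S`: analytic univalent functions on the disk with
`f 0 = 0` and `f' 0 = 1`. -/
structure IsUnivalentNormalized (f : ℂ → ℂ) : Prop where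
  analytic : DifferentiableOn ℂ f disk
  map_zero : f 0 = 0
  deriv_zero : deriv f 0 = 1
  univalent : InjOn f disk

/-- Subordination `F ≺ G`: there is an analytic self-map `ω` of the disk with `ω 0 = 0` and
`F = G ∘ ω` on the disk. -/
def Subordinate (F G : ℂ → ℂ) : Prop :=
  ∃ ω : ℂ → ℂ, DifferentiableOn ℂ ω disk ∧ MapsTo ω disk disk ∧ ω 0 = 0 ∧
    ∀ z ∈ disk, F z = G (ω z)

/-- Ma–Minda functions: analytic and univalent on the disk, with positive real part, the image
being symmetric in the real axis and starlike with respect to `φ 0 = 1`, and `φ' 0 > 0`. -/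
structure IsMaMinda (φ : ℂ → ℂ) : Prop where
  analytic : DifferentiableOn ℂ φ disk
  univalent : InjOn φ disk
  re_pos : ∀ z ∈ disk, 0 < (φ z).re
  symmetric : ∀ w ∈ φ '' disk, (starRingEnd ℂ) w ∈ φ '' disk
  map_zero : φ 0 = 1
  starlike : StarConvex ℝ (1 : ℂ) (φ '' disk)
  deriv_im : (deriv φ 0).im = 0
  deriv_pos : 0 < (deriv φ 0).re

/-- The Hardy class `H²` of the disk: analytic functions whose quadratic means over the circles
`|z| = r`, `0 ≤ r < 1`, are bounded. -/
def IsHardyTwo (f : ℂ → ℂ) : Prop :=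
  DifferentiableOn ℂ f disk ∧
    ∃ C : ℝ, ∀ r ∈ Ico (0 : ℝ) 1, Real.circleAverage (fun z => ‖f z‖ ^ 2) 0 r ≤ C

/-- `z ↦ 1 + z f''(z) / f'(z)`. For univalent `f` the derivative has no zero on the disk. -/
def convexityQuotient (f : ℂ → ℂ) (z : ℂ) : ℂ := 1 + z * deriv (deriv f) z / deriv f z

/-- The Ma–Minda convex class `C(φ)`. -/
def IsConvexClass (φ f : ℂ → ℂ) : Prop :=
  IsUnivalentNormalized f ∧ Subordinate (convexityQuotient f) φ

/-- `k ∈ S` is the extremal function of `C(φ)`: `1 + z k''(z) / k'(z) = φ(z)` on the disk. -/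
def IsConvexExtremal (φ k : ℂ → ℂ) : Prop :=
  IsUnivalentNormalized k ∧ ∀ z ∈ disk, convexityQuotient k z = φ z

/-- The rotation `z ↦ e^{-iθ} f(e^{iθ} z)`. -/
def rotation (θ : ℝ) (f : ℂ → ℂ) (z : ℂ) : ℂ :=
  Complex.exp (-(θ * Complex.I)) * f (Complex.exp (θ * Complex.I) * z)

/-- The majorant series `r + ∑_{n ≥ 2} |a_n| r^n` of `f(z) = z + ∑_{n ≥ 2} a_n z^n`. -/
def majorant (f : ℂ → ℂ) (r : ℝ) : ℝ := r + ∑' n : ℕ, ‖coeff f (n + 2)‖ * r ^ (n + 2)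

/-- The Euclidean distance `d(f(0), ∂f(𝔻))`. -/
def boundaryDist (f : ℂ → ℂ) : ℝ := Metric.infDist (f 0) (frontier (f '' disk))

end

end MaMinda

namespace MaMinda

/-! ### Taylor coefficients on the unit disk -/

/-! Put `s = φ - 1`. For `f` in the class, `z f''/f' = s ∘ ω` with a Schwarz function `ω`, so `f' =
exp Q` with `z Q' = s ∘ ω`; for the extremal function `k' = exp P` with `z P' = s`. The Bohr
inequality is the chain `M_f(r) ≤ M_k(r) = k(r) ≤ k(r_f) = -k(-1) ≤ d(f(0), ∂f(𝔻))`, whose two ends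
are separate comparisons of `f` with `k`.

Majorants (`absSum_le`): Bohr's theorem applied to `ω(z)/z` gives `M_ω(r) ≤ r` for `r ≤ 1/3`, hence
`M_{s∘ω} ≤ M_s` there. The equation `z f'' = (s ∘ ω) f'` turns this into a bound for the logarithmic
derivative of `M_{f'}` by that of `M_{k'}`, with equality for `k` because all its coefficients are
nonnegative. Two integrations give `M_f ≤ M_k`. This is the only place where `1/3` enters.

Distance (`koebe_le_boundaryDist`): a minimum argument gives `Re Q(z) ≥ Re P(-|z|)`, that is
`|f'(z)| ≥ k'(-|z|)` (`re_log_deriv_ge`); integrating along the preimage of a segment from `0` to a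
boundary point bounds that point's modulus below by `-k(-r)` for every `r < 1`
(`le_norm_of_mem_frontier_image`).

The growth function `-k(-t)` increases and stays below `t` by a definite gap, while `k(t) ≥ t`;
hence `-k(-1)` exists in `(0,1)` and `r_f` comes from the intermediate value theorem. Sharpness
holds since a rotation changes neither the majorant nor the modulus `-k(-1)` of the boundary point
reached radially.

That the primitive `k` of `exp P` is univalent follows from `Re φ > 0`: the tangent to the image of
each circle turns monotonically through `2π`, which gives injectivity on circles (`injOn_circle`),
and a continuity argument in the radius extends it to the disk (`chordQuotient_ne_zero`). -/

theorem mem_disk {z : ℂ} : z ∈ disk ↔ ‖z‖ < 1 := by simp [disk]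

theorem isOpen_disk : IsOpen disk := Metric.isOpen_ball

theorem zero_mem_disk : (0 : ℂ) ∈ disk := by simp [disk]

theorem disk_mem_nhds {z : ℂ} (hz : z ∈ disk) : disk ∈ 𝓝 z := isOpen_disk.mem_nhds hz

theorem isPreconnected_disk : IsPreconnected disk := (convex_ball (0 : ℂ) 1).isPreconnected

theorem differentiableOn_deriv {f : ℂ → ℂ} (hf : DifferentiableOn ℂ f disk) :
    DifferentiableOn ℂ (deriv f) disk := hf.deriv isOpen_disk

theorem hasDerivAt_of_mem_disk {f : ℂ → ℂ} (hf : DifferentiableOn ℂ f disk) {z : ℂ}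
    (hz : z ∈ disk) : HasDerivAt f (deriv f z) z :=
  (hf.differentiableAt (disk_mem_nhds hz)).hasDerivAt

theorem _root_.HasSum.congr_fun' {α β : Type*} [AddCommMonoid α] [TopologicalSpace α]
    {f g : β → α} {a : α} (h : HasSum f a) (hfg : ∀ b, f b = g b) : HasSum g a :=
  funext hfg ▸ h

theorem hasSum_coeff {f : ℂ → ℂ} (hf : DifferentiableOn ℂ f disk) {z : ℂ} (hz : ‖z‖ < 1) :
    HasSum (fun n => coeff f n * z ^ n) (f z) := by
  have h := Complex.hasSum_taylorSeries_on_ball hf (z := z) (by simpa using hz)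
  refine h.congr_fun' fun n => ?_
  simp only [coeff, sub_zero, smul_eq_mul]
  ring

theorem summable_norm_coeff {f : ℂ → ℂ} (hf : DifferentiableOn ℂ f disk) {r : ℝ} (h0 : 0 ≤ r)
    (h1 : r < 1) : Summable fun n => ‖coeff f n‖ * r ^ n := by
  have h := (hasSum_coeff hf (z := (r : ℂ)) (by simpa [abs_of_nonneg h0] using h1)).summable.norm
  simpa [abs_of_nonneg h0] using h

theorem coeff_eq_of_hasSum {f : ℂ → ℂ} {c : ℕ → ℂ} {ρ : ℝ} (hρ : 0 < ρ)
    (hf : AnalyticAt ℂ f 0)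
    (h : ∀ z : ℂ, ‖z‖ < ρ → HasSum (fun n => c n * z ^ n) (f z)) : coeff f = c := by
  -- Summability at the single point `ρ / 2` bounds the radius of convergence from below; any
  -- positive radius suffices for uniqueness.
  have h1 : HasFPowerSeriesOnBall f (FormalMultilinearSeries.ofScalars ℂ c) 0
      (ENNReal.ofReal (ρ / 2)) := by
    refine ⟨?_, by simpa using hρ, ?_⟩
    · refine FormalMultilinearSeries.le_radius_of_summable _ ?_
      have := (h ((ρ / 2 : ℝ) : ℂ) (by
        rw [Complex.norm_real, Real.norm_of_nonneg (by positivity)]; linarith)).summable.norm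
      refine this.congr fun n => ?_
      rw [FormalMultilinearSeries.ofScalars_norm]
      simp [abs_of_pos hρ, max_eq_left (by positivity : (0 : ℝ) ≤ ρ / 2)]
    · intro y hy
      have hy' : ‖y‖ < ρ := by
        have : ‖y‖ < ρ / 2 := by
          rw [Metric.mem_eball, edist_zero_right, ← ofReal_norm] at hy
          exact (ENNReal.ofReal_lt_ofReal_iff (by positivity)).1 hy
        linarith
      have := h y hy'
      simpa [FormalMultilinearSeries.ofScalars_apply_eq, mul_comm] using this
  have h2 := hf.hasFPowerSeriesAt
  exact FormalMultilinearSeries.ofScalars_series_injective ℂ ℂ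
    (h2.eq_formalMultilinearSeries h1.hasFPowerSeriesAt)

theorem analyticAt_zero {f : ℂ → ℂ} (hf : DifferentiableOn ℂ f disk) : AnalyticAt ℂ f 0 :=
  hf.analyticAt (disk_mem_nhds zero_mem_disk)

theorem coeff_congr {f g : ℂ → ℂ} (h : EqOn f g disk) : coeff f = coeff g := by
  ext n
  have : f =ᶠ[𝓝 0] g := by
    filter_upwards [disk_mem_nhds zero_mem_disk] with z hz using h hz
  simp [coeff, this.iteratedDeriv_eq n]

theorem coeff_zero (f : ℂ → ℂ) : coeff f 0 = f 0 := by simp [coeff]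

theorem coeff_one (f : ℂ → ℂ) : coeff f 1 = deriv f 0 := by simp [coeff, iteratedDeriv_one]

theorem coeff_deriv (f : ℂ → ℂ) (n : ℕ) : coeff (deriv f) n = (n + 1) * coeff f (n + 1) := by
  have : (n.factorial : ℂ) ≠ 0 := by exact_mod_cast n.factorial_ne_zero
  have h' : (n : ℂ) + 1 ≠ 0 := by exact_mod_cast n.succ_ne_zero
  simp only [coeff, iteratedDeriv_succ', Nat.factorial_succ]
  push_cast
  field_simp

theorem coeff_mul {f g : ℂ → ℂ} (hf : DifferentiableOn ℂ f disk)
    (hg : DifferentiableOn ℂ g disk) (n : ℕ) :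
    coeff (fun z => f z * g z) n
      = ∑ p ∈ Finset.HasAntidiagonal.antidiagonal n, coeff f p.1 * coeff g p.2 := by
  refine congrFun (coeff_eq_of_hasSum (f := fun z => f z * g z) (c := fun n =>
    ∑ p ∈ Finset.HasAntidiagonal.antidiagonal n, coeff f p.1 * coeff g p.2)
    one_pos (analyticAt_zero (hf.fun_mul hg)) fun z hz => ?_) n
  have hF := (hasSum_coeff hf hz)
  have hG := (hasSum_coeff hg hz)
  have hs := (summable_norm_sum_mul_antidiagonal_of_summable_norm hF.summable.norm
    hG.summable.norm).of_norm.hasSum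
  rw [← tsum_mul_tsum_eq_tsum_sum_antidiagonal_of_summable_norm hF.summable.norm
    hG.summable.norm, hF.tsum_eq, hG.tsum_eq] at hs
  refine hs.congr_fun' fun n => ?_
  rw [Finset.sum_mul]
  refine Finset.sum_congr rfl fun p hp => ?_
  rw [← Finset.HasAntidiagonal.mem_antidiagonal.1 hp, pow_add]
  ring

theorem coeff_id_mul_deriv {f : ℂ → ℂ} (hf : DifferentiableOn ℂ f disk) (n : ℕ) :
    coeff (fun z => z * deriv f z) n = n * coeff f n := by
  refine congrFun (coeff_eq_of_hasSum (f := fun z => z * deriv f z) (c := fun n => n * coeff f n)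
    one_pos
    (analyticAt_zero ((differentiableOn_id (𝕜 := ℂ)).fun_mul (differentiableOn_deriv hf))) fun z hz => ?_) n
  have h := (hasSum_coeff (differentiableOn_deriv hf) hz).mul_left z
  rw [← hasSum_nat_add_iff' 1]
  simp only [Finset.range_one, Finset.sum_singleton, Nat.cast_zero, zero_mul, sub_zero]
  refine h.congr_fun' fun n => ?_
  rw [coeff_deriv]
  push_cast
  ring

theorem conj_eq_of_real_coeff {f : ℂ → ℂ} (hf : DifferentiableOn ℂ f disk)
    (hr : ∀ n, (coeff f n).im = 0) {z : ℂ} (hz : ‖z‖ < 1) :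
    f ((starRingEnd ℂ) z) = (starRingEnd ℂ) (f z) := by
  have h1 := hasSum_coeff hf (z := (starRingEnd ℂ) z) (by simpa using hz)
  have h2 := Complex.hasSum_conj'.2 (hasSum_coeff hf hz)
  refine h1.unique ?_
  convert h2 using 2 with n
  simp [Complex.conj_eq_iff_im.2 (hr n)]

theorem im_eq_zero_of_real_coeff {f : ℂ → ℂ} (hf : DifferentiableOn ℂ f disk)
    (hr : ∀ n, (coeff f n).im = 0) {t : ℝ} (ht : |t| < 1) : (f t).im = 0 := by
  have := conj_eq_of_real_coeff hf hr (z := (t : ℂ)) (by simpa using ht)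
  rw [Complex.conj_ofReal] at this
  exact Complex.conj_eq_iff_im.1 this.symm

/-! ### Logarithms of derivatives -/

/-- Since `ψ` vanishes at the origin, `ψ(z)/z` extends analytically as `dslope ψ 0`, and a disk
admits primitives. -/
theorem exists_euler_primitive {ψ : ℂ → ℂ} (hψ : DifferentiableOn ℂ ψ disk) (h0 : ψ 0 = 0) :
    ∃ Q : ℂ → ℂ, DifferentiableOn ℂ Q disk ∧ Q 0 = 0 ∧ ∀ z ∈ disk, z * deriv Q z = ψ z := by
  have hd : DifferentiableOn ℂ (dslope ψ 0) disk :=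
    (Complex.differentiableOn_dslope (disk_mem_nhds zero_mem_disk)).2 hψ
  obtain ⟨Q, hQ0, hQ⟩ := (DifferentiableOn.isExactOn_ball hd).with_val_at 0 0
  refine ⟨Q, fun z hz => (hQ z hz).differentiableAt.differentiableWithinAt, hQ0, fun z hz => ?_⟩
  rw [(hQ z hz).deriv]
  simpa [h0] using sub_smul_dslope ψ 0 z

/-- The product `f' e^{-Q}` is constant. That `f'` has no zeros is not assumed but comes out of the
formula. -/
theorem deriv_eq_exp {f ψ Q : ℂ → ℂ} (hf : DifferentiableOn ℂ f disk) (hd : deriv f 0 = 1)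
    (hq : ∀ z ∈ disk, convexityQuotient f z = 1 + ψ z) (hQ : DifferentiableOn ℂ Q disk)
    (hQ0 : Q 0 = 0) (hQψ : ∀ z ∈ disk, z * deriv Q z = ψ z) {z : ℂ} (hz : z ∈ disk) :
    deriv f z = Complex.exp (Q z) := by
  have hf' := differentiableOn_deriv hf
  set h : ℂ → ℂ := fun z => deriv f z * Complex.exp (-Q z) with hh
  have hder : ∀ w ∈ disk, HasDerivAt h
      ((deriv (deriv f) w - deriv f w * deriv Q w) * Complex.exp (-Q w)) w := fun w hw => by
    exact ((hasDerivAt_of_mem_disk hf' hw).mul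
      (hasDerivAt_of_mem_disk hQ hw).neg.cexp).congr_deriv (by simp only [Pi.neg_apply]; ring)
  have hdiff : DifferentiableOn ℂ h disk :=
    fun w hw => (hder w hw).differentiableAt.differentiableWithinAt
  -- The quotient is informative only where `f' ≠ 0` and `z ≠ 0`. Near the origin this is known from
  -- `f'(0) = 1`, and the identity theorem carries `h' = 0` to the whole disk.
  have hzero : ∀ᶠ w in 𝓝[≠] (0 : ℂ), deriv h w = 0 := by
    have hne : ∀ᶠ w in 𝓝 (0 : ℂ), deriv f w ≠ 0 :=
      (hf'.continuousOn.continuousAt (disk_mem_nhds zero_mem_disk)).eventually_ne (by simp [hd])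
    filter_upwards [nhdsWithin_le_nhds hne, nhdsWithin_le_nhds (disk_mem_nhds zero_mem_disk),
      self_mem_nhdsWithin] with w hw hwd hw0
    have hw0 : w ≠ 0 := hw0
    rw [(hder w hwd).deriv]
    have h1 : w * deriv (deriv f) w / deriv f w = w * deriv Q w := by
      rw [hQψ w hwd]
      simpa [convexityQuotient] using hq w hwd
    rw [div_eq_iff hw] at h1
    have h2 : deriv (deriv f) w = deriv f w * deriv Q w :=
      mul_left_cancel₀ hw0 (by rw [h1]; ring)
    simp [h2]
  have hall : EqOn (deriv h) 0 disk :=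
    ((differentiableOn_deriv hdiff).analyticOnNhd
      isOpen_disk).eqOn_of_preconnected_of_frequently_eq (analyticOnNhd_const (v := (0 : ℂ)))
      isPreconnected_disk zero_mem_disk hzero.frequently
  have hc := isOpen_disk.is_const_of_deriv_eq_zero isPreconnected_disk hdiff hall hz zero_mem_disk
  simp only [hh, hd, hQ0, Complex.exp_zero, Complex.exp_neg] at hc
  field_simp at hc
  exact hc

theorem exists_log_deriv {f ψ : ℂ → ℂ} (hf : DifferentiableOn ℂ f disk) (hd : deriv f 0 = 1)
    (hψ : DifferentiableOn ℂ ψ disk) (h0 : ψ 0 = 0)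
    (hq : ∀ z ∈ disk, convexityQuotient f z = 1 + ψ z) :
    ∃ Q : ℂ → ℂ, DifferentiableOn ℂ Q disk ∧ Q 0 = 0 ∧ (∀ z ∈ disk, z * deriv Q z = ψ z) ∧
      ∀ z ∈ disk, deriv f z = Complex.exp (Q z) := by
  obtain ⟨Q, hQ, hQ0, hQψ⟩ := exists_euler_primitive hψ h0
  exact ⟨Q, hQ, hQ0, hQψ, fun z hz => deriv_eq_exp hf hd hq hQ hQ0 hQψ hz⟩

/-! ### Univalence of convex functions -/

/-- A closed curve whose tangent angle is strictly increasing has no self-intersection within an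
arc along which the tangent turns by at most `π`. -/
theorem ne_of_tangent_turns_le_pi {γ : ℝ → ℂ} {ρ α : ℝ → ℝ} {a b : ℝ} (hab : a < b)
    (hγ : ∀ t, HasDerivAt γ (ρ t * Complex.exp (α t * Complex.I)) t) (hρ : ∀ t, 0 < ρ t)
    (hα : StrictMono α) (hturn : α b - α a ≤ Real.pi) : γ a ≠ γ b := by
  intro heq
  -- Project onto the mean tangent direction: inside the arc the tangent angle is within `π/2` of
  -- `μ`, so the projection strictly increases.
  set μ := (α a + α b) / 2
  have hd : ∀ t, HasDerivAt (fun t => (Complex.exp (-(μ * Complex.I)) * γ t).re)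
      (ρ t * Real.cos (α t - μ)) t := fun t => by
    have h := (((hγ t).const_mul (Complex.exp (-(μ * Complex.I)))))
    have h2 := Complex.reCLM.hasFDerivAt.comp_hasDerivAt t h
    refine h2.congr_deriv ?_
    have : Complex.exp (-(μ * Complex.I)) * (ρ t * Complex.exp (α t * Complex.I))
        = ρ t * Complex.exp (((α t - μ : ℝ) : ℂ) * Complex.I) := by
      rw [mul_left_comm, ← Complex.exp_add]
      push_cast
      ring_nf
    rw [Complex.reCLM_apply, this, Complex.re_ofReal_mul, Complex.exp_ofReal_mul_I_re]
  have hmono : StrictMonoOn (fun t => (Complex.exp (-(μ * Complex.I)) * γ t).re) (Icc a b) := by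
    refine strictMonoOn_of_deriv_pos (convex_Icc a b)
      (fun t _ => (hd t).continuousAt.continuousWithinAt) fun t ht => ?_
    rw [interior_Icc] at ht
    rw [(hd t).deriv]
    refine mul_pos (hρ t) (Real.cos_pos_of_mem_Ioo ⟨?_, ?_⟩)
    · have := hα ht.1
      simp only [μ]; linarith
    · have := hα ht.2
      simp only [μ]; linarith
  have := hmono (left_mem_Icc.2 hab.le) (right_mem_Icc.2 hab.le) hab
  simp [heq] at this

/-- Along `t ↦ R e^{it}` the image curve has tangent angle `t + Im P + π/2`, whose derivative `Re(1
+ z P')` is positive. -/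
theorem injOn_circle {k P : ℂ → ℂ} (hk : DifferentiableOn ℂ k disk)
    (hP : DifferentiableOn ℂ P disk) (hkP : ∀ z ∈ disk, deriv k z = Complex.exp (P z))
    (hre : ∀ z ∈ disk, 0 < (1 + z * deriv P z).re) {z w : ℂ} (hz : ‖z‖ < 1) (hzw : ‖z‖ = ‖w‖)
    (hne : z ≠ w) : k z ≠ k w := by
  have hR : 0 < ‖z‖ := by
    rcases (norm_nonneg z).eq_or_lt with h | h
    · exact absurd ((norm_eq_zero.1 h.symm).trans (norm_eq_zero.1 (hzw ▸ h.symm)).symm) hne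
    · exact h
  set R := ‖z‖ with hRdef
  let c : ℝ → ℂ := fun t => R * Complex.exp (t * Complex.I)
  have hcn : ∀ t, ‖c t‖ = R := fun t => by
    simp [c, abs_of_pos hR, Complex.norm_exp_ofReal_mul_I]
  have hcd : ∀ t, c t ∈ disk := fun t => by rw [mem_disk, hcn]; exact hz
  have hc : ∀ t, HasDerivAt c (c t * Complex.I) t := fun t => by
    have := (((hasDerivAt_id t).ofReal_comp.mul_const Complex.I).cexp).const_mul (R : ℂ)
    refine this.congr_deriv ?_
    simp only [c, id]
    push_cast
    ring
  have hcper : ∀ t, c (t + 2 * Real.pi) = c t := fun t => by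
    simp only [c]
    push_cast
    rw [add_mul, Complex.exp_add, Complex.exp_two_pi_mul_I, mul_one]
  let α : ℝ → ℝ := fun t => t + (P (c t)).im + Real.pi / 2
  let ρ : ℝ → ℝ := fun t => R * Real.exp (P (c t)).re
  have hρ : ∀ t, 0 < ρ t := fun t => mul_pos hR (Real.exp_pos _)
  have hγ : ∀ t, HasDerivAt (fun t => k (c t)) (ρ t * Complex.exp (α t * Complex.I)) t := by
    intro t
    refine ((hasDerivAt_of_mem_disk hk (hcd t)).comp t (hc t)).congr_deriv ?_
    rw [hkP _ (hcd t)]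
    simp only [ρ, α, c]
    set p := P (R * Complex.exp (t * Complex.I))
    push_cast
    have h1 : Complex.exp p = Complex.exp p.re * Complex.exp (p.im * Complex.I) := by
      rw [← Complex.exp_add, Complex.re_add_im]
    rw [h1, add_mul, add_mul, Complex.exp_add, Complex.exp_add, Complex.exp_pi_div_two_mul_I]
    ring
  have hα : StrictMono α := by
    have hd : ∀ t, HasDerivAt α (1 + c t * deriv P (c t)).re t := fun t => by
      have h := (hasDerivAt_of_mem_disk hP (hcd t)).comp t (hc t)
      have h2 := Complex.imCLM.hasFDerivAt.comp_hasDerivAt t h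
      refine (((hasDerivAt_id t).add h2).add_const (Real.pi / 2)).congr_deriv ?_
      simp
      ring
    exact strictMono_of_deriv_pos fun t => by rw [(hd t).deriv]; exact hre _ (hcd t)
  -- The total turning is `2π`, so one of the two complementary arcs between the points turns by at
  -- most `π`.
  have key : ∀ a b : ℝ, a < b → b < a + 2 * Real.pi → k (c a) ≠ k (c b) := by
    intro a b hab hb
    by_cases h : α b - α a ≤ Real.pi
    · exact ne_of_tangent_turns_le_pi hab hγ hρ hα h
    · have := ne_of_tangent_turns_le_pi hb hγ hρ hα (by
        simp only [α, hcper] at h ⊢; linarith)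
      simp only [hcper] at this
      exact this.symm
  have harg : ∀ u : ℂ, ‖u‖ = R → u = c u.arg := fun u hu => by
    simp only [c]; rw [← hu, Complex.norm_mul_exp_arg_mul_I]
  have hzarg := harg z rfl
  have hwarg := harg w hzw.symm
  have := Complex.neg_pi_lt_arg z
  have := Complex.neg_pi_lt_arg w
  have := Complex.arg_le_pi z
  have := Complex.arg_le_pi w
  rcases lt_trichotomy z.arg w.arg with h | h | h
  · have := key _ _ h (by linarith)
    rwa [← hzarg, ← hwarg] at this
  · exact absurd (by rw [hzarg, hwarg, h]) hne
  · have := key _ _ h (by linarith)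
    rw [← hzarg, ← hwarg] at this
    exact this.symm

/-- The divided difference `(k z - k (λ z)) / (z - λ z)` as a power series. -/
noncomputable def chordQuotient (k : ℂ → ℂ) (z l : ℂ) : ℂ :=
  ∑' n : ℕ, coeff k (n + 1) * z ^ n * ∑ j ∈ Finset.range (n + 1), l ^ j

theorem norm_chordQuotient_term_le (k : ℂ → ℂ) {z l : ℂ} {R : ℝ} (hz : ‖z‖ ≤ R) (hl : ‖l‖ ≤ 1)
    (n : ℕ) : ‖coeff k (n + 1) * z ^ n * ∑ j ∈ Finset.range (n + 1), l ^ j‖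
      ≤ ‖coeff (deriv k) n‖ * R ^ n := by
  have h1 : ‖∑ j ∈ Finset.range (n + 1), l ^ j‖ ≤ n + 1 := by
    refine (norm_sum_le _ _).trans ?_
    refine (Finset.sum_le_sum (g := fun _ => (1 : ℝ)) fun j _ => ?_).trans (by simp)
    rw [norm_pow]
    exact pow_le_one₀ (norm_nonneg _) hl
  have h2 : ‖coeff (deriv k) n‖ = (n + 1) * ‖coeff k (n + 1)‖ := by
    rw [coeff_deriv, norm_mul]
    congr 1
    exact_mod_cast Complex.norm_natCast (n + 1)
  rw [h2, norm_mul, norm_mul, norm_pow]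
  calc ‖coeff k (n + 1)‖ * ‖z‖ ^ n * ‖∑ j ∈ Finset.range (n + 1), l ^ j‖
      ≤ ‖coeff k (n + 1)‖ * R ^ n * (n + 1) := by
        have := (norm_nonneg z).trans hz
        gcongr
    _ = _ := by ring

theorem continuousOn_chordQuotient {k : ℂ → ℂ} (hk : DifferentiableOn ℂ k disk) {R : ℝ}
    (h0 : 0 ≤ R) (h1 : R < 1) :
    ContinuousOn (fun p : ℂ × ℂ => chordQuotient k p.1 p.2)
      (Metric.closedBall 0 R ×ˢ Metric.closedBall 0 1) := by
  refine continuousOn_tsum (fun n => by fun_prop)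
    (summable_norm_coeff (differentiableOn_deriv hk) h0 h1) ?_
  rintro n ⟨z, l⟩ ⟨hz, hl⟩
  exact norm_chordQuotient_term_le k (by simpa using hz) (by simpa using hl) n

theorem differentiableOn_chordQuotient {k : ℂ → ℂ} (hk : DifferentiableOn ℂ k disk) {z : ℂ}
    (hz : ‖z‖ < 1) : DifferentiableOn ℂ (chordQuotient k z) disk := by
  refine Complex.differentiableOn_tsum_of_summable_norm
    (summable_norm_coeff (differentiableOn_deriv hk) (norm_nonneg z) hz)
    (fun n => by fun_prop) isOpen_disk ?_
  intro n l hl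
  exact norm_chordQuotient_term_le k le_rfl (mem_disk.1 hl).le n

theorem mul_chordQuotient {k : ℂ → ℂ} (hk : DifferentiableOn ℂ k disk) {z l : ℂ}
    (hz : ‖z‖ < 1) (hl : ‖l‖ ≤ 1) : z * (1 - l) * chordQuotient k z l = k z - k (l * z) := by
  have hlz : ‖l * z‖ < 1 := by
    rw [norm_mul]
    exact (mul_le_of_le_one_left (norm_nonneg z) hl).trans_lt hz
  have h := ((hasSum_coeff hk hz).sub (hasSum_coeff hk hlz))
  rw [← hasSum_nat_add_iff' 1] at h
  simp only [Finset.range_one, Finset.sum_singleton, pow_zero, mul_one, sub_self, sub_zero] at h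
  rw [chordQuotient, ← tsum_mul_left, ← h.tsum_eq]
  refine tsum_congr fun n => ?_
  have := mul_neg_geom_sum l (n + 1)
  rw [mul_pow]
  linear_combination coeff k (n + 1) * z ^ (n + 1) * this

theorem chordQuotient_one {k : ℂ → ℂ} (hk : DifferentiableOn ℂ k disk) {z : ℂ} (hz : ‖z‖ < 1) :
    chordQuotient k z 1 = deriv k z := by
  rw [← (hasSum_coeff (differentiableOn_deriv hk) hz).tsum_eq]
  refine tsum_congr fun n => ?_
  rw [coeff_deriv]
  simp
  ring

theorem chordQuotient_zero (k : ℂ → ℂ) (l : ℂ) : chordQuotient k 0 l = deriv k 0 := by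
  rw [chordQuotient, tsum_eq_single 0]
  · simp [coeff_one]
  · intro n hn
    simp [hn]

/-- On `|λ| = 1` zeros are excluded by injectivity on circles, and at `λ = 1` by `k' ≠ 0`. Shrink
`z` to `t z`: the set of `t` for which no zero occurs in `|λ| ≤ 1` is open by compactness, closed by
a uniform lower bound, and contains `t = 0`, where the quotient is the constant `k'(0)`. -/
theorem chordQuotient_ne_zero {k : ℂ → ℂ} (hk : DifferentiableOn ℂ k disk)
    (hd : ∀ z ∈ disk, deriv k z ≠ 0)
    (hcirc : ∀ z w : ℂ, ‖z‖ < 1 → ‖z‖ = ‖w‖ → z ≠ w → k z ≠ k w) {z l : ℂ} (hz : ‖z‖ < 1)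
    (hl : ‖l‖ ≤ 1) : chordQuotient k z l ≠ 0 := by
  have hsphere : ∀ z l : ℂ, ‖z‖ < 1 → ‖l‖ = 1 → chordQuotient k z l ≠ 0 := by
    intro z l hz hl
    by_cases hl1 : l = 1
    · rw [hl1, chordQuotient_one hk hz]
      exact hd z (mem_disk.2 hz)
    · by_cases hz0 : z = 0
      · rw [hz0, chordQuotient_zero]
        exact hd 0 zero_mem_disk
      · have h := hcirc z (l * z) hz (by rw [norm_mul, hl, one_mul]) fun h =>
          hl1 (mul_right_cancel₀ hz0 (by rw [one_mul]; exact h.symm))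
        rw [← sub_ne_zero, ← mul_chordQuotient hk hz hl.le] at h
        exact right_ne_zero_of_mul h
  let F : unitInterval × Metric.closedBall (0 : ℂ) 1 → ℂ :=
    fun p => chordQuotient k ((p.1 : ℝ) * z) p.2
  have htz : ∀ t : unitInterval, ‖((t : ℝ) : ℂ) * z‖ ≤ ‖z‖ := fun t => by
    rw [norm_mul, Complex.norm_real, Real.norm_of_nonneg t.2.1]
    exact mul_le_of_le_one_left (norm_nonneg z) t.2.2
  have hF : Continuous F := by
    refine (continuousOn_chordQuotient hk (norm_nonneg z) hz).comp_continuous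
      (f := fun p : unitInterval × Metric.closedBall (0 : ℂ) 1 =>
        ((((p.1 : ℝ) : ℂ) * z, (p.2 : ℂ)) : ℂ × ℂ)) (by fun_prop) fun p => ⟨?_, p.2.2⟩
    simpa using htz p.1
  obtain ⟨c, hc0, hc⟩ : ∃ c : ℝ, 0 < c ∧ ∀ t : unitInterval, ∀ l : Metric.closedBall (0 : ℂ) 1,
      ‖(l : ℂ)‖ = 1 → c ≤ ‖F (t, l)‖ := by
    have hcpt : IsCompact {p : unitInterval × Metric.closedBall (0 : ℂ) 1 | ‖(p.2 : ℂ)‖ = 1} :=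
      (isClosed_eq (by fun_prop) continuous_const).isCompact
    obtain ⟨p, hp, hmin⟩ := hcpt.exists_isMinOn ⟨(0, ⟨1, by simp⟩), by simp⟩
      hF.norm.continuousOn
    exact ⟨‖F p‖, norm_pos_iff.2 (hsphere _ _ ((htz p.1).trans_lt hz) hp),
      fun t l hl => hmin (show (t, l) ∈ _ from hl)⟩
  -- The maximum principle for the reciprocal: without zeros inside, the bound `c` on the unit
  -- circle, uniform in `t`, holds throughout the closed disk.
  have hmax : ∀ t : unitInterval, (∀ l, F (t, l) ≠ 0) → ∀ l, c ≤ ‖F (t, l)‖ := by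
    intro t ht l
    have hcont : ContinuousOn (fun l => (chordQuotient k ((t : ℝ) * z) l)⁻¹)
        (Metric.closedBall 0 1) := by
      rw [continuousOn_iff_continuous_domRestrict]
      exact (hF.comp (Continuous.prodMk_right t)).inv₀ ht
    have hdc : DiffContOnCl ℂ (fun l => (chordQuotient k ((t : ℝ) * z) l)⁻¹)
        (Metric.ball 0 1) := by
      refine ⟨(differentiableOn_chordQuotient hk ((htz t).trans_lt hz)).inv
        fun l hl => ht ⟨l, Metric.ball_subset_closedBall hl⟩, ?_⟩
      rwa [closure_ball _ one_ne_zero]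
    have := Complex.norm_le_of_forall_mem_frontier_norm_le Metric.isBounded_ball hdc
      (C := c⁻¹) (fun l hl => by
        rw [frontier_ball _ one_ne_zero] at hl
        rw [norm_inv]
        exact inv_anti₀ hc0 (hc t ⟨l, Metric.sphere_subset_closedBall hl⟩ (by simpa using hl)))
      (z := l) (by rw [closure_ball _ one_ne_zero]; exact l.2)
    rw [norm_inv] at this
    exact (inv_le_inv₀ (norm_pos_iff.2 (ht l)) hc0).1 this
  have hclopen : IsClopen {t : unitInterval | ∀ l, F (t, l) ≠ 0} := by
    constructor
    · have : {t : unitInterval | ∀ l, F (t, l) ≠ 0} = ⋂ l, {t | c ≤ ‖F (t, l)‖} := by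
        ext t
        simp only [mem_ofPred_eq, mem_iInter]
        exact ⟨hmax t, fun h l => norm_pos_iff.1 (hc0.trans_le (h l))⟩
      rw [this]
      exact isClosed_iInter fun l => isClosed_le continuous_const (by fun_prop)
    · have : {t : unitInterval | ∀ l, F (t, l) ≠ 0}ᶜ = Prod.fst '' {p | F p = 0} := by
        ext t
        simp
      rw [← isClosed_compl_iff, this]
      exact isClosedMap_fst_of_compactSpace _ (isClosed_eq hF continuous_const)
  have huniv := hclopen.eq_univ ⟨0, fun l => by
    have : F (0, l) = deriv k 0 := by simp [F, chordQuotient_zero]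
    rw [this]
    exact hd 0 zero_mem_disk⟩
  have h1 : (1 : unitInterval) ∈ {t : unitInterval | ∀ l, F (t, l) ≠ 0} := huniv ▸ mem_univ _
  simpa [F] using h1 ⟨l, by simpa using hl⟩

/-- An analytic function whose derivative does not vanish and which is injective on every circle
about the origin is injective. -/
theorem injOn_of_injOn_circles {k : ℂ → ℂ} (hk : DifferentiableOn ℂ k disk)
    (hd : ∀ z ∈ disk, deriv k z ≠ 0)
    (hcirc : ∀ z w : ℂ, ‖z‖ < 1 → ‖z‖ = ‖w‖ → z ≠ w → k z ≠ k w) : InjOn k disk := by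
  have main : ∀ z w : ℂ, ‖z‖ < 1 → ‖w‖ ≤ ‖z‖ → k z = k w → z = w := by
    intro z w hz hwz hkzw
    by_cases hz0 : z = 0
    · rw [hz0, norm_zero] at hwz
      rw [hz0, norm_le_zero_iff.1 hwz]
    have hl : ‖w / z‖ ≤ 1 := by
      rw [norm_div]
      exact div_le_one_of_le₀ hwz (norm_nonneg z)
    have h := mul_chordQuotient hk hz hl
    rw [div_mul_cancel₀ w hz0, hkzw, sub_self, mul_eq_zero, mul_eq_zero] at h
    rcases h with (h | h) | h
    · exact absurd h hz0
    · rw [sub_eq_zero, eq_div_iff hz0, one_mul] at h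
      exact h
    · exact absurd h (chordQuotient_ne_zero hk hd hcirc hz hl)
  intro z hz w hw h
  rcases le_total ‖w‖ ‖z‖ with hle | hle
  · exact main z w (mem_disk.1 hz) hle h
  · exact (main w z (mem_disk.1 hw) hle h.symm).symm

theorem exists_isConvexExtremal {φ : ℂ → ℂ} (hφ : DifferentiableOn ℂ φ disk)
    (hre : ∀ z ∈ disk, 0 < (φ z).re) (h0 : φ 0 = 1) : ∃ k, IsConvexExtremal φ k := by
  obtain ⟨P, hP, hP0, hPφ⟩ := exists_euler_primitive (ψ := fun z => φ z - 1)
    (hφ.sub_const 1) (by simp [h0])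
  have hexp : DifferentiableOn ℂ (fun z => Complex.exp (P z)) disk := hP.cexp
  obtain ⟨k, hk0, hk⟩ := (DifferentiableOn.isExactOn_ball hexp).with_val_at 0 0
  have hkd : DifferentiableOn ℂ k disk :=
    fun z hz => (hk z hz).differentiableAt.differentiableWithinAt
  have hk' : ∀ z ∈ disk, deriv k z = Complex.exp (P z) := fun z hz => (hk z hz).deriv
  have hPφ' : ∀ z ∈ disk, 1 + z * deriv P z = φ z := fun z hz => by
    rw [hPφ z hz]; ring
  refine ⟨k, ⟨hkd, hk0, ?_, ?_⟩, fun z hz => ?_⟩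
  · rw [hk' 0 zero_mem_disk, hP0, Complex.exp_zero]
  · exact injOn_of_injOn_circles hkd
      (fun z hz => by rw [hk' z hz]; exact Complex.exp_ne_zero _)
      fun z w hz hzw hne => injOn_circle hkd hP hk' (fun z hz => by rw [hPφ' z hz]; exact hre z hz)
        hz hzw hne
  · have : deriv k =ᶠ[𝓝 z] fun z => Complex.exp (P z) := by
      filter_upwards [disk_mem_nhds hz] with w hw using hk' w hw
    rw [convexityQuotient, this.deriv_eq, (hasDerivAt_of_mem_disk hP hz).cexp.deriv, hk' z hz,
      ← hPφ' z hz]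
    field_simp

/-! ### Distortion and growth -/

theorem not_forall_le_of_hasDerivAt_pos {h : ℝ → ℝ} {D a b : ℝ} (hab : a < b)
    (hD : HasDerivAt h D b) (hpos : 0 < D) : ¬ ∀ t ∈ Ioo a b, h b ≤ h t := by
  intro hmin
  have h1 : ∀ᶠ t in 𝓝[<] b, 0 < slope h b t :=
    ((hasDerivAt_iff_tendsto_slope.1 hD).eventually_const_lt hpos).filter_mono
      (nhdsWithin_mono _ fun t (ht : t < b) => ht.ne)
  obtain ⟨t, ht1, ht2⟩ := (h1.and (Ioo_mem_nhdsLT hab)).exists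
  rw [slope_def_field] at ht1
  have := div_nonpos_of_nonneg_of_nonpos (sub_nonneg.2 (hmin t ht2)) (sub_nonpos.2 ht2.2.le)
  linarith

/-- Minimize `Re Q(w) - Re P(-|w|) + ε|w|` over a closed disk. At a minimum `w ≠ 0` the tangential
derivative forces `s(ω(w))` to be real, hence `ω(w)` to be real, and Schwarz's lemma with
monotonicity of `s` on the real axis makes the radial derivative positive, a contradiction. So the
minimum is at the origin. -/
theorem re_log_deriv_ge {s ω P Q : ℂ → ℂ} (hs : DifferentiableOn ℂ s disk)
    (hinj : InjOn s disk) (hreal : ∀ n, (coeff s n).im = 0)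
    (hmono : MonotoneOn (fun t : ℝ => (s t).re) (Ioo (-1) 1))
    (hω : DifferentiableOn ℂ ω disk) (hωd : MapsTo ω disk disk) (hω0 : ω 0 = 0)
    (hP : DifferentiableOn ℂ P disk) (hP0 : P 0 = 0) (hPs : ∀ z ∈ disk, z * deriv P z = s z)
    (hQ : DifferentiableOn ℂ Q disk) (hQ0 : Q 0 = 0)
    (hQs : ∀ z ∈ disk, z * deriv Q z = s (ω z)) {z : ℂ} (hz : ‖z‖ < 1) :
    (P (-(‖z‖ : ℂ))).re ≤ (Q z).re := by
  suffices H : ∀ ε > 0, 0 ≤ (Q z).re - (P (-(‖z‖ : ℂ))).re + ε * ‖z‖ by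
    refine le_of_forall_pos_le_add fun ε hε => ?_
    have := H ε hε
    nlinarith [norm_nonneg z]
  intro ε hε
  set u : ℂ → ℝ := fun w => (Q w).re - (P (-(‖w‖ : ℂ))).re + ε * ‖w‖ with hu
  have hmaps : MapsTo (fun w : ℂ => -(‖w‖ : ℂ)) (Metric.closedBall 0 ‖z‖) disk := fun w hw => by
    rw [mem_disk]
    simpa using (mem_closedBall_zero_iff.1 hw).trans_lt hz
  have hsub : Metric.closedBall (0 : ℂ) ‖z‖ ⊆ disk := Metric.closedBall_subset_ball hz
  have hucont : ContinuousOn u (Metric.closedBall 0 ‖z‖) := by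
    refine ((Complex.continuous_re.comp_continuousOn (hQ.continuousOn.mono hsub)).sub
      (Complex.continuous_re.comp_continuousOn
        (hP.continuousOn.comp (by fun_prop) hmaps))).add (by fun_prop)
  obtain ⟨w, hw, hmin⟩ := (isCompact_closedBall (0 : ℂ) ‖z‖).exists_isMinOn ⟨0, by simp⟩ hucont
  have hwn : ‖w‖ ≤ ‖z‖ := mem_closedBall_zero_iff.1 hw
  have hw1 : ‖w‖ < 1 := hwn.trans_lt hz
  have hwd : w ∈ disk := mem_disk.2 hw1
  suffices hw0 : w = 0 by
    have := hmin (show z ∈ Metric.closedBall (0 : ℂ) ‖z‖ by simp)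
    simpa [hw0, hu, hQ0, hP0] using this
  by_contra hw0
  have hr : 0 < ‖w‖ := norm_pos_iff.2 hw0
  -- On the circle through `w` only `Re Q` varies; its angular derivative is `-Im(w Q'(w))`.
  have him : (s (ω w)).im = 0 := by
    have hc : HasDerivAt (fun t : ℝ => w * Complex.exp (t * Complex.I)) (w * Complex.I) 0 := by
      have := (((hasDerivAt_id (0 : ℝ)).ofReal_comp.mul_const Complex.I).cexp).const_mul w
      exact this.congr_deriv (by simp)
    have hQd : HasDerivAt Q (deriv Q w) (w * Complex.exp ((0 : ℝ) * Complex.I)) := by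
      simpa using hasDerivAt_of_mem_disk hQ hwd
    have hd := Complex.reCLM.hasFDerivAt.comp_hasDerivAt (0 : ℝ) (hQd.comp (0 : ℝ) hc)
    have hloc : IsLocalMin (fun t : ℝ => Complex.reCLM (Q (w * Complex.exp (t * Complex.I)))) 0 :=
      Eventually.of_forall fun t => by
        have hn : ‖w * Complex.exp (t * Complex.I)‖ = ‖w‖ := by
          rw [norm_mul, Complex.norm_exp_ofReal_mul_I, mul_one]
        have := hmin (show w * Complex.exp (t * Complex.I) ∈ Metric.closedBall (0 : ℂ) ‖z‖ by
          rw [mem_closedBall_zero_iff, hn]; exact hwn)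
        simp only [hu, mem_ofPred_eq, hn] at this
        simp only [Complex.reCLM_apply, Complex.ofReal_zero, zero_mul, Complex.exp_zero, mul_one]
        linarith
    have h0 := hloc.hasDerivAt_eq_zero hd
    rw [← hQs w hwd]
    simp only [Complex.reCLM_apply] at h0
    rw [← mul_assoc, mul_comm (deriv Q w) w, Complex.mul_I_re] at h0
    linarith
  -- As `s` commutes with conjugation and is injective, a real value is taken only at a real point.
  obtain ⟨x, hx⟩ : ∃ x : ℝ, ω w = x := by
    have hωw := mem_disk.1 (hωd hwd)
    have h1 := conj_eq_of_real_coeff hs hreal hωw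
    rw [Complex.conj_eq_iff_im.2 him] at h1
    have h2 := hinj (mem_disk.2 (by simpa using hωw)) (mem_disk.2 hωw) h1
    exact ⟨(ω w).re, (Complex.conj_eq_iff_re.1 h2).symm⟩
  have hxw : |x| ≤ ‖w‖ := by
    have := Complex.norm_le_norm_of_mapsTo_ball hω
      (hωd.mono_right Metric.ball_subset_closedBall) hω0 hw1
    simpa [hx] using this
  have hsx : (s (-(‖w‖ : ℂ))).re ≤ (s (ω w)).re := by
    have := abs_le.1 hxw
    have h := hmono (a := -‖w‖) (b := x) ⟨by linarith, by linarith⟩ ⟨by linarith, by linarith⟩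
      this.1
    simpa [hx] using h
  have hnd : -(‖w‖ : ℂ) ∈ disk := mem_disk.2 (by simpa using hw1)
  have hQr : HasDerivAt (fun t : ℝ => (Q (t * w)).re) (w * deriv Q w).re 1 := by
    have hc : HasDerivAt (fun t : ℝ => (t : ℂ) * w) w 1 := by
      simpa using (hasDerivAt_id (1 : ℝ)).ofReal_comp.mul_const w
    have hQd : HasDerivAt Q (deriv Q w) (((1 : ℝ) : ℂ) * w) := by
      simpa using hasDerivAt_of_mem_disk hQ hwd
    exact (Complex.reCLM.hasFDerivAt.comp_hasDerivAt (1 : ℝ) (hQd.comp (1 : ℝ) hc)).congr_deriv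
      (by simp [mul_comm])
  have hPr : HasDerivAt (fun t : ℝ => (P (t * -(‖w‖ : ℂ))).re)
      (-(‖w‖ : ℂ) * deriv P (-(‖w‖ : ℂ))).re 1 := by
    have hc : HasDerivAt (fun t : ℝ => (t : ℂ) * -(‖w‖ : ℂ)) (-(‖w‖ : ℂ)) 1 := by
      simpa using (hasDerivAt_id (1 : ℝ)).ofReal_comp.mul_const (-(‖w‖ : ℂ))
    have hQd : HasDerivAt P (deriv P (-(‖w‖ : ℂ))) (((1 : ℝ) : ℂ) * -(‖w‖ : ℂ)) := by
      simpa using hasDerivAt_of_mem_disk hP hnd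
    exact (Complex.reCLM.hasFDerivAt.comp_hasDerivAt (1 : ℝ) (hQd.comp (1 : ℝ) hc)).congr_deriv
      (by simp [mul_comm])
  have hlin : HasDerivAt (fun t : ℝ => ε * (t * ‖w‖)) (ε * ‖w‖) 1 := by
    simpa using ((hasDerivAt_id (1 : ℝ)).mul_const ‖w‖).const_mul ε
  have htot := (hQr.sub hPr).add hlin
  rw [hQs w hwd, hPs _ hnd] at htot
  -- The radial derivative is `Re s(ω(w)) - Re s(-|w|) + ε|w|`; the `ε` term makes it strictly
  -- positive.
  refine not_forall_le_of_hasDerivAt_pos zero_lt_one htot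
    (by have := mul_pos hε hr; linarith) fun t ht => ?_
  have hn : ‖(t : ℂ) * w‖ = t * ‖w‖ := by
    rw [norm_mul, Complex.norm_real, Real.norm_of_nonneg ht.1.le]
  have := hmin (show (t : ℂ) * w ∈ Metric.closedBall (0 : ℂ) ‖z‖ by
    rw [mem_closedBall_zero_iff, hn]
    exact (mul_le_of_le_one_left hr.le ht.2.le).trans hwn)
  simp only [hu, mem_ofPred_eq, hn] at this
  simpa using this

theorem isOpen_image {f : ℂ → ℂ} (hf : DifferentiableOn ℂ f disk)
    (hd : ∀ z ∈ disk, deriv f z ≠ 0) {U : Set ℂ} (hU : IsOpen U) (hUd : U ⊆ disk) :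
    IsOpen (f '' U) := by
  rw [isOpen_iff_mem_nhds]
  rintro _ ⟨z, hz, rfl⟩
  have hst : HasStrictDerivAt f (deriv f z) z :=
    ((hf.analyticAt (disk_mem_nhds (hUd hz))).hasStrictDerivAt)
  rw [← hst.map_nhds_eq (hd z (hUd hz))]
  exact image_mem_map (hU.mem_nhds hz)

theorem hasDerivAt_invFunOn {f : ℂ → ℂ} (hf : DifferentiableOn ℂ f disk) (hinj : InjOn f disk)
    (hd : ∀ z ∈ disk, deriv f z ≠ 0) {z : ℂ} (hz : z ∈ disk) :
    HasDerivAt (Function.invFunOn f disk) (deriv f z)⁻¹ (f z) := by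
  have hst : HasStrictDerivAt f (deriv f z) z :=
    ((hf.analyticAt (disk_mem_nhds hz)).hasStrictDerivAt)
  refine (hst.to_local_left_inverse (hd z hz) ?_).hasDerivAt
  filter_upwards [disk_mem_nhds hz] with w hw using hinj.leftInvOn_invFunOn hw

/-- Needed because `Metric.infDist` to the empty set is `0`. An empty frontier would make the image
all of `ℂ` and the inverse a bounded entire function, against Liouville. -/
theorem frontier_image_nonempty {f : ℂ → ℂ} (hf : DifferentiableOn ℂ f disk)
    (hinj : InjOn f disk) (hd : ∀ z ∈ disk, deriv f z ≠ 0) : (frontier (f '' disk)).Nonempty := by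
  by_contra hne
  rw [not_nonempty_iff_eq_empty, ← isClopen_iff_frontier_eq_empty] at hne
  have huniv := hne.eq_univ ⟨f 0, mem_image_of_mem f zero_mem_disk⟩
  have hdiff : Differentiable ℂ (Function.invFunOn f disk) := fun v => by
    obtain ⟨z, hz, rfl⟩ : v ∈ f '' disk := huniv ▸ mem_univ v
    exact (hasDerivAt_invFunOn hf hinj hd hz).differentiableAt
  have hbdd : Bornology.IsBounded (range (Function.invFunOn f disk)) := by
    refine (Metric.isBounded_ball : Bornology.IsBounded disk).subset ?_
    rintro _ ⟨v, rfl⟩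
    exact Function.invFunOn_mem (huniv ▸ mem_univ v : v ∈ f '' disk)
  have hhalf : (1 / 2 : ℂ) ∈ disk := by rw [mem_disk]; norm_num
  have := hdiff.apply_eq_apply_of_bounded hbdd (f 0) (f (1 / 2))
  rw [hinj.leftInvOn_invFunOn zero_mem_disk, hinj.leftInvOn_invFunOn hhalf] at this
  norm_num at this

/-- Lift the segment from `0` towards `w` through the inverse `g` until it first leaves the image.
As `|g'| = 1/|f'| ≤ 1/K'`, the function `K(|g(tw)|) - t|w|` does not increase. If `|w| < K R`, the
lift stays in the closed disk of radius `R`, whose image is compact, so the exit point would still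
be in the image. -/
theorem le_norm_of_mem_frontier_image {f : ℂ → ℂ} (hf : DifferentiableOn ℂ f disk)
    (hinj : InjOn f disk) (h0 : f 0 = 0) (hd : ∀ z ∈ disk, deriv f z ≠ 0) {K K' : ℝ → ℝ}
    (hK : ∀ t ∈ Ico (0 : ℝ) 1, HasDerivAt K (K' t) t) (hK0 : K 0 = 0)
    (hK' : ∀ t ∈ Ico (0 : ℝ) 1, 0 < K' t) (hfK : ∀ z ∈ disk, K' ‖z‖ ≤ ‖deriv f z‖)
    {w : ℂ} (hw : w ∈ frontier (f '' disk)) {R : ℝ} (hR : R ∈ Ico (0 : ℝ) 1) : K R ≤ ‖w‖ := by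
  by_contra! hlt
  have hopen : IsOpen (f '' disk) := isOpen_image hf hd isOpen_disk subset_rfl
  have hwn : w ∉ f '' disk := by
    rw [hopen.frontier_eq] at hw
    exact hw.2
  have hw0 : w ≠ 0 := fun h => hwn (h ▸ ⟨0, zero_mem_disk, h0⟩)
  have hKmono : StrictMonoOn K (Ico 0 1) :=
    strictMonoOn_of_deriv_pos (convex_Ico 0 1)
      (fun t ht => (hK t ht).continuousAt.continuousWithinAt) fun t ht => by
        have := interior_subset ht
        rw [(hK t this).deriv]
        exact hK' t this
  have hTc : IsCompact {t ∈ Icc (0 : ℝ) 1 | (t : ℂ) * w ∉ f '' disk} :=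
    isCompact_Icc.inter_right (hopen.isClosed_compl.preimage (by fun_prop))
  obtain ⟨b, ⟨hb, hbn⟩, hleast⟩ := hTc.exists_isLeast ⟨1, by simp, by simpa using hwn⟩
  have hbpos : 0 < b := hb.1.lt_of_ne fun h =>
    hbn ⟨0, zero_mem_disk, by rw [h0, ← h]; simp⟩
  have hin : ∀ t ∈ Ico 0 b, (t : ℂ) * w ∈ f '' disk := fun t ht => by
    by_contra hcon
    exact absurd (hleast ⟨⟨ht.1, ht.2.le.trans hb.2⟩, hcon⟩) (not_le.2 ht.2)
  set g := Function.invFunOn f disk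
  have hgd : ∀ t ∈ Ico 0 b, g (t * w) ∈ disk := fun t ht => Function.invFunOn_mem (hin t ht)
  have hfg : ∀ t ∈ Ico 0 b, f (g (t * w)) = t * w := fun t ht => Function.invFunOn_eq (hin t ht)
  have hder : ∀ t ∈ Ico 0 b,
      HasDerivAt (fun t : ℝ => g (t * w)) ((deriv f (g (t * w)))⁻¹ * w) t := fun t ht => by
    have hc : HasDerivAt (fun t : ℝ => (t : ℂ) * w) w t := by
      simpa using (hasDerivAt_id t).ofReal_comp.mul_const w
    have h1 := hasDerivAt_invFunOn hf hinj hd (hgd t ht)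
    rw [hfg t ht] at h1
    exact h1.comp t hc
  have hnIco : ∀ t ∈ Ico 0 b, ‖g (t * w)‖ ∈ Ico (0 : ℝ) 1 := fun t ht =>
    ⟨norm_nonneg _, mem_disk.1 (hgd t ht)⟩
  have hcont : ContinuousOn (fun t : ℝ => K ‖g (t * w)‖ - t * ‖w‖) (Ico 0 b) := fun t ht =>
    ((ContinuousAt.comp (f := fun t : ℝ => ‖g (t * w)‖) (hK _ (hnIco t ht)).continuousAt
      (hder t ht).continuousAt.norm).sub
      (by fun_prop : ContinuousAt (fun t : ℝ => t * ‖w‖) t)).continuousWithinAt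
  -- The norm is differentiable only away from the origin, so the initial time `t = 0` is left to
  -- continuity.
  have hnorm : ∀ t ∈ Ioo 0 b, ∃ D, HasDerivAt (fun t : ℝ => ‖g (t * w)‖) D t ∧
      D ≤ ‖(deriv f (g (t * w)))⁻¹ * w‖ := fun t ht => by
    have ht' := Ioo_subset_Ico_self ht
    have hne : g (t * w) ≠ 0 := fun h => by
      have := hfg t ht'
      rw [h, h0] at this
      exact mul_ne_zero (Complex.ofReal_ne_zero.2 ht.1.ne') hw0 this.symm
    have hpos := norm_pos_iff.2 hne
    have h := (hder t ht').norm_sq.sqrt (by positivity)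
    simp only [Real.sqrt_sq (norm_nonneg _)] at h
    refine ⟨_, h, ?_⟩
    rw [mul_div_mul_left _ _ two_ne_zero, div_le_iff₀ hpos]
    exact (real_inner_le_norm _ _).trans_eq (mul_comm _ _)
  have hanti : AntitoneOn (fun t : ℝ => K ‖g (t * w)‖ - t * ‖w‖) (Ico 0 b) := by
    have hder2 : ∀ t ∈ interior (Ico 0 b), ∃ D,
        HasDerivAt (fun t : ℝ => K ‖g (t * w)‖ - t * ‖w‖) D t ∧ D ≤ 0 := fun t ht => by
      rw [interior_Ico] at ht
      have ht' := Ioo_subset_Ico_self ht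
      obtain ⟨D, hD, hDle⟩ := hnorm t ht
      refine ⟨_, ((hK _ (hnIco t ht')).comp t hD).sub ((hasDerivAt_id t).mul_const ‖w‖), ?_⟩
      have hf0 : 0 < ‖deriv f (g (t * w))‖ := norm_pos_iff.2 (hd _ (hgd t ht'))
      have h1 : K' ‖g (t * w)‖ * D ≤ ‖w‖ := by
        calc K' ‖g (t * w)‖ * D ≤ K' ‖g (t * w)‖ * ‖(deriv f (g (t * w)))⁻¹ * w‖ :=
              mul_le_mul_of_nonneg_left hDle (hK' _ (hnIco t ht')).le
          _ ≤ ‖deriv f (g (t * w))‖ * ‖(deriv f (g (t * w)))⁻¹ * w‖ :=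
              mul_le_mul_of_nonneg_right (hfK _ (hgd t ht')) (norm_nonneg _)
          _ = ‖w‖ := by
              rw [norm_mul, norm_inv, mul_inv_cancel_left₀ hf0.ne']
      linarith
    refine antitoneOn_of_deriv_nonpos (convex_Ico 0 b) hcont
      (fun t ht => (hder2 t ht).choose_spec.1.differentiableAt.differentiableWithinAt)
      fun t ht => ?_
    rw [(hder2 t ht).choose_spec.1.deriv]
    exact (hder2 t ht).choose_spec.2
  have hbound : ∀ t ∈ Ico 0 b, (t : ℂ) * w ∈ f '' Metric.closedBall 0 R := fun t ht => by
    refine ⟨g (t * w), ?_, hfg t ht⟩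
    rw [mem_closedBall_zero_iff]
    by_contra! hcon
    have h1 := hanti ⟨le_rfl, hbpos⟩ ht ht.1
    have hg0 : g 0 = 0 := by
      simpa [h0] using hinj.leftInvOn_invFunOn zero_mem_disk
    simp only [Complex.ofReal_zero, zero_mul, hg0, norm_zero, hK0, sub_zero] at h1
    have h2 := hKmono hR (hnIco t ht) hcon
    have h3 : t * ‖w‖ ≤ ‖w‖ := mul_le_of_le_one_left (norm_nonneg w) (ht.2.le.trans hb.2)
    linarith
  have hsub : Metric.closedBall (0 : ℂ) R ⊆ disk := Metric.closedBall_subset_ball hR.2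
  have hclosed : IsClosed (f '' Metric.closedBall 0 R) :=
    ((isCompact_closedBall 0 R).image_of_continuousOn (hf.continuousOn.mono hsub)).isClosed
  have hlim : Tendsto (fun t : ℝ => (t : ℂ) * w) (𝓝[<] b) (𝓝 (b * w)) :=
    ((by fun_prop : Continuous fun t : ℝ => (t : ℂ) * w).tendsto b).mono_left nhdsWithin_le_nhds
  refine hbn (image_mono hsub (hclosed.mem_of_tendsto hlim ?_))
  filter_upwards [Ioo_mem_nhdsLT hbpos] with t ht using hbound t (Ioo_subset_Ico_self ht)

/-- If the limit were `f z` with `|z| < ρ < 1`, openness and injectivity would trap the points `γ i`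
in the disk of radius `ρ`, although their moduli tend to `1`. -/
theorem mem_frontier_image_of_tendsto {f : ℂ → ℂ} (hf : DifferentiableOn ℂ f disk)
    (hinj : InjOn f disk) (hd : ∀ z ∈ disk, deriv f z ≠ 0) {ι : Type*} {l : Filter ι} [l.NeBot]
    {γ : ι → ℂ} {w : ℂ} (hγ : ∀ᶠ i in l, γ i ∈ disk) (hnorm : Tendsto (fun i => ‖γ i‖) l (𝓝 1))
    (hw : Tendsto (fun i => f (γ i)) l (𝓝 w)) : w ∈ frontier (f '' disk) := by
  rw [(isOpen_image hf hd isOpen_disk subset_rfl).frontier_eq]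
  refine ⟨mem_closure_of_tendsto hw (hγ.mono fun i hi => mem_image_of_mem f hi), ?_⟩
  rintro ⟨z, hz, rfl⟩
  obtain ⟨ρ, hzρ, hρ⟩ := exists_between (mem_disk.1 hz)
  have hsub : Metric.ball (0 : ℂ) ρ ⊆ disk := Metric.ball_subset_ball hρ.le
  have hmem : f '' Metric.ball 0 ρ ∈ 𝓝 (f z) :=
    (isOpen_image hf hd Metric.isOpen_ball hsub).mem_nhds
      (mem_image_of_mem f (mem_ball_zero_iff.2 hzρ))
  obtain ⟨i, hi1, hi2, hi3⟩ := (hγ.and ((hw.eventually_mem hmem).and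
    (hnorm.eventually_const_lt hρ))).exists
  rw [hinj.mem_image_iff hsub hi1, mem_ball_zero_iff] at hi2
  linarith

/-! ### Coefficient bounds and Bohr's theorem -/

theorem circleAverage_div_pow {χ : ℂ → ℂ} (hχ : DifferentiableOn ℂ χ disk) (n : ℕ) {ρ : ℝ}
    (h0 : 0 < ρ) (h1 : ρ < 1) :
    Real.circleAverage (fun z => χ z / z ^ n) 0 ρ = coeff χ n := by
  have hdc : DiffContOnCl ℂ χ (Metric.ball 0 ρ) :=
    (hχ.mono (Metric.closedBall_subset_ball h1)).diffContOnCl_ball subset_rfl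
  have h := hdc.circleIntegral_one_div_sub_center_pow_smul h0 n
  rw [Real.circleAverage_eq_circleIntegral h0.ne', coeff]
  have hfun : (fun z : ℂ => (z - 0)⁻¹ • (χ z / z ^ n)) =
      fun z => (1 / (z - 0) ^ (n + 1)) • χ z := by
    ext z
    simp only [sub_zero, smul_eq_mul, pow_succ]
    field_simp
  rw [hfun, h, smul_eq_mul, smul_eq_mul]
  have := Complex.two_pi_I_ne_zero
  field_simp

theorem exists_norm_eq_one_mul_eq_norm (c : ℂ) : ∃ u : ℂ, ‖u‖ = 1 ∧ u * c = ‖c‖ := by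
  refine ⟨Complex.exp (((-c.arg : ℝ) : ℂ) * Complex.I), Complex.norm_exp_ofReal_mul_I _, ?_⟩
  have h : Complex.exp (((-c.arg : ℝ) : ℂ) * Complex.I) * (‖c‖ * Complex.exp (c.arg * Complex.I))
      = ‖c‖ := by
    rw [mul_left_comm, ← Complex.exp_add]
    simp
  rwa [Complex.norm_mul_exp_arg_mul_I] at h

/-- Average the nonnegative product `(1 - Re(eχ))(1 - Re b)` over a circle, with `b = v ρ^n / z^n`
unimodular there; `e` and `v` align the phases of the coefficients of orders `0` and `n`. -/
theorem norm_coeff_le {χ : ℂ → ℂ} (hχ : DifferentiableOn ℂ χ disk)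
    (hb : ∀ z ∈ disk, ‖χ z‖ ≤ 1) {n : ℕ} (hn : n ≠ 0) :
    ‖coeff χ n‖ ≤ 2 * (1 - ‖coeff χ 0‖) := by
  obtain ⟨e, he, hec⟩ := exists_norm_eq_one_mul_eq_norm (coeff χ 0)
  obtain ⟨v, hv, hvc⟩ : ∃ v : ℂ, ‖v‖ = 1 ∧ e * v * coeff χ n = -‖coeff χ n‖ := by
    obtain ⟨u, hu, huc⟩ := exists_norm_eq_one_mul_eq_norm (e * coeff χ n)
    refine ⟨-u, by rw [norm_neg, hu], ?_⟩
    rw [norm_mul, he, one_mul] at huc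
    linear_combination -huc
  have key : ∀ ρ ∈ Ioo (0 : ℝ) 1, ‖coeff χ n‖ * ρ ^ n ≤ 2 * (1 - ‖coeff χ 0‖) := by
    rintro ρ ⟨h0, h1⟩
    have hρ : (ρ : ℂ) ≠ 0 := Complex.ofReal_ne_zero.2 h0.ne'
    -- On the circle `b̄ = v̄ z^n / ρ^n`. Thus `A` collects the terms analytic in the disk,
    -- averaging to `A 0`; the remaining term `eχb/2` averages to `-‖coeff χ n‖ ρ^n / 2`.
    set A : ℂ → ℂ := fun z => 1 - e * χ z - (starRingEnd ℂ) v * z ^ n / ρ ^ n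
      + e * (starRingEnd ℂ) v * χ z * z ^ n / (2 * ρ ^ n) with hA
    have hAd : DifferentiableOn ℂ A disk := by
      refine (((differentiableOn_const _).sub (hχ.const_mul e)).sub
        (by fun_prop)).add (((hχ.const_mul _).mul (by fun_prop)).div_const _)
    have hA0 : A 0 = 1 - ‖coeff χ 0‖ := by
      rw [coeff_zero] at hec ⊢
      simp [hA, hn, hec]
    have hsub : Metric.closedBall (0 : ℂ) ρ ⊆ disk := Metric.closedBall_subset_ball h1
    have hsph : Metric.sphere (0 : ℂ) |ρ| ⊆ disk := by
      rw [abs_of_pos h0]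
      exact Metric.sphere_subset_closedBall.trans hsub
    have hAavg : Real.circleAverage A 0 ρ = 1 - ‖coeff χ 0‖ := by
      rw [← hA0]
      refine DiffContOnCl.circleAverage ?_
      rw [abs_of_pos h0]
      exact (hAd.mono hsub).diffContOnCl_ball subset_rfl
    have hne : ∀ z ∈ Metric.sphere (0 : ℂ) |ρ|, z ≠ 0 := fun z hz h => by
      rw [h, mem_sphere_zero_iff_norm, norm_zero, abs_of_pos h0] at hz
      exact h0.ne hz
    have hAint : CircleIntegrable A 0 ρ :=
      ContinuousOn.circleIntegrable' (hAd.continuousOn.mono hsph)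
    have hBint : CircleIntegrable (fun z => (e * v * ρ ^ n / 2) • (χ z / z ^ n)) 0 ρ :=
      ContinuousOn.circleIntegrable' (((hχ.continuousOn.mono hsph).div (by fun_prop)
        fun z hz => pow_ne_zero n (hne z hz)).const_smul (e * v * ρ ^ n / 2))
    have hG : Real.circleAverage (fun z => A z + (e * v * ρ ^ n / 2) • (χ z / z ^ n)) 0 ρ
        = 1 - ‖coeff χ 0‖ - ‖coeff χ n‖ * ρ ^ n / 2 := by
      rw [Real.circleAverage_fun_add hAint hBint, hAavg, Real.circleAverage_fun_smul,
        circleAverage_div_pow hχ n h0 h1, smul_eq_mul]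
      linear_combination (ρ : ℂ) ^ n / 2 * hvc
    have hre := Complex.reCLM.circleAverage_comp_comm (hAint.add hBint)
    have hnn : 0 ≤ Real.circleAverage (Complex.reCLM ∘ (A + fun z =>
        (e * v * ρ ^ n / 2) • (χ z / z ^ n))) 0 ρ := by
      refine Real.circleAverage_nonneg_of_nonneg fun z hz => ?_
      have hz0 := hne z hz
      have hzn : ‖z‖ = ρ := by simpa [abs_of_pos h0] using hz
      have h2 : z ^ n / ρ ^ n = (starRingEnd ℂ) (ρ ^ n / z ^ n) := by
        have h3 : z * (starRingEnd ℂ) z = ρ ^ 2 := by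
          rw [Complex.mul_conj, Complex.normSq_eq_norm_sq, hzn]
          push_cast; rfl
        have hcz : (starRingEnd ℂ) z ≠ 0 := (map_ne_zero _).2 hz0
        rw [map_div₀, map_pow, map_pow, Complex.conj_ofReal, div_eq_div_iff (pow_ne_zero _ hρ)
          (pow_ne_zero _ hcz), ← mul_pow, ← mul_pow, h3, sq]
      set b : ℂ := v * (ρ ^ n / z ^ n) with hb'
      have hbn : ‖b‖ = 1 := by
        rw [hb', norm_mul, hv, norm_div, norm_pow, norm_pow, hzn, Complex.norm_real,
          Real.norm_of_nonneg h0.le, div_self (pow_ne_zero n h0.ne'), one_mul]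
      have hcb : (starRingEnd ℂ) v * (z ^ n / ρ ^ n) = (starRingEnd ℂ) b := by
        rw [h2, hb', map_mul]
      have hval : A z + (e * v * ρ ^ n / 2) • (χ z / z ^ n)
          = 1 - e * χ z - (starRingEnd ℂ) b + e * χ z * (b + (starRingEnd ℂ) b) / 2 := by
        rw [← hcb, hA, hb', smul_eq_mul]
        ring
      have hre2 : (A z + (e * v * ρ ^ n / 2) • (χ z / z ^ n)).re
          = (1 - (e * χ z).re) * (1 - b.re) := by
        rw [hval, Complex.add_conj]
        have : e * χ z * ((2 * b.re : ℝ) : ℂ) / 2 = e * χ z * (b.re : ℂ) := by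
          push_cast; ring
        rw [this]
        simp only [Complex.add_re, Complex.sub_re, Complex.one_re, Complex.conj_re,
          Complex.re_mul_ofReal]
        ring
      simp only [Function.comp_apply, Pi.add_apply, Complex.reCLM_apply]
      rw [hre2]
      have h4 : (e * χ z).re ≤ 1 := (Complex.re_le_norm _).trans (by
        rw [norm_mul, he, one_mul]; exact hb z (hsph hz))
      have h5 : b.re ≤ 1 := (Complex.re_le_norm _).trans hbn.le
      exact mul_nonneg (by linarith) (by linarith)
    rw [hre] at hnn
    have hG' : Real.circleAverage (A + fun z => (e * v * ρ ^ n / 2) • (χ z / z ^ n)) 0 ρ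
        = ((1 - ‖coeff χ 0‖ - ‖coeff χ n‖ * ρ ^ n / 2 : ℝ) : ℂ) := by
      push_cast
      exact hG
    rw [hG', Complex.reCLM_apply, Complex.ofReal_re] at hnn
    linarith
  have hlim : Tendsto (fun ρ : ℝ => ‖coeff χ n‖ * ρ ^ n) (𝓝[<] 1) (𝓝 (‖coeff χ n‖)) := by
    have : Continuous fun ρ : ℝ => ‖coeff χ n‖ * ρ ^ n := by fun_prop
    simpa using (this.tendsto 1).mono_left nhdsWithin_le_nhds
  refine le_of_tendsto hlim ?_
  filter_upwards [Ioo_mem_nhdsLT (zero_lt_one' ℝ)] with ρ hρ using key ρ hρ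

/-- The majorant series `∑ |a_n| r^n`. -/
noncomputable def absSum (f : ℂ → ℂ) (r : ℝ) : ℝ := ∑' n, ‖coeff f n‖ * r ^ n

theorem absSum_congr {f g : ℂ → ℂ} (h : EqOn f g disk) : absSum f = absSum g := by
  ext r; rw [absSum, absSum, coeff_congr h]

theorem absSum_nonneg (f : ℂ → ℂ) {r : ℝ} (hr : 0 ≤ r) : 0 ≤ absSum f r :=
  tsum_nonneg fun n => by positivity

theorem absSum_zero (f : ℂ → ℂ) : absSum f 0 = ‖f 0‖ := by
  rw [absSum, tsum_eq_single 0]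
  · simp [coeff_zero]
  · intro n hn
    simp [hn]

theorem absSum_mul_le {f g : ℂ → ℂ} (hf : DifferentiableOn ℂ f disk)
    (hg : DifferentiableOn ℂ g disk) {r : ℝ} (h0 : 0 ≤ r) (h1 : r < 1) :
    absSum (fun z => f z * g z) r ≤ absSum f r * absSum g r := by
  have hF := summable_norm_coeff hf h0 h1
  have hG := summable_norm_coeff hg h0 h1
  have hsum := summable_norm_sum_mul_antidiagonal_of_summable_norm hF.norm hG.norm
  rw [absSum, absSum, absSum,
    tsum_mul_tsum_eq_tsum_sum_antidiagonal_of_summable_norm hF.norm hG.norm]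
  refine Summable.tsum_le_tsum (fun n => ?_) (summable_norm_coeff (hf.fun_mul hg) h0 h1)
    hsum.of_norm
  rw [coeff_mul hf hg]
  refine (mul_le_mul_of_nonneg_right (norm_sum_le _ _) (by positivity)).trans_eq ?_
  rw [Finset.sum_mul]
  refine Finset.sum_congr rfl fun p hp => ?_
  rw [← Finset.HasAntidiagonal.mem_antidiagonal.1 hp, pow_add, norm_mul]
  ring

theorem absSum_pow_le {f : ℂ → ℂ} (hf : DifferentiableOn ℂ f disk) {r : ℝ} (h0 : 0 ≤ r)
    (h1 : r < 1) (n : ℕ) : absSum (fun z => f z ^ n) r ≤ absSum f r ^ n := by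
  induction n with
  | zero =>
    have : coeff (fun z => f z ^ 0) = fun n => if n = 0 then 1 else 0 := by
      refine coeff_eq_of_hasSum one_pos (by simpa using analyticAt_const) fun z _ => ?_
      convert hasSum_single (f := fun n => (if n = 0 then (1 : ℂ) else 0) * z ^ n) 0
        (fun n hn => by simp [hn]) using 1
      simp
    rw [absSum, this, tsum_eq_single 0 fun n hn => by simp [hn]]
    simp
  | succ n ih =>
    simp only [pow_succ]
    exact (absSum_mul_le (hf.fun_pow n) hf h0 h1).trans
      (mul_le_mul_of_nonneg_right ih (absSum_nonneg f h0))

/-- Expand `s ∘ ω` as a double series and rearrange. The majorant of `ω^n` is at most `r^n` by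
submultiplicativity, which also gives the absolute convergence. -/
theorem absSum_comp_le {s ω : ℂ → ℂ} (hs : DifferentiableOn ℂ s disk)
    (hω : DifferentiableOn ℂ ω disk) (hωd : MapsTo ω disk disk) (hω0 : ω 0 = 0) {r : ℝ}
    (h0 : 0 ≤ r) (h1 : r < 1) (hr : absSum ω r ≤ r) :
    absSum (fun z => s (ω z)) r ≤ absSum s r := by
  rcases h0.eq_or_lt with rfl | hpos
  · rw [absSum_zero, absSum_zero, hω0]
  set a : ℕ → ℕ → ℂ := fun n m => coeff s n * coeff (fun z => ω z ^ n) m with ha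
  have hpow : ∀ n, absSum (fun z => ω z ^ n) r ≤ r ^ n := fun n =>
    (absSum_pow_le hω h0 h1 n).trans (pow_le_pow_left₀ (absSum_nonneg ω h0) hr n)
  have hrow : ∀ n, HasSum (fun m => ‖a n m‖ * r ^ m)
      (‖coeff s n‖ * absSum (fun z => ω z ^ n) r) := fun n => by
    refine ((summable_norm_coeff (hω.fun_pow n) h0 h1).hasSum.mul_left ‖coeff s n‖).congr_fun'
      fun m => ?_
    rw [ha, norm_mul]
    ring
  have hrows : Summable fun n => ‖coeff s n‖ * absSum (fun z => ω z ^ n) r :=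
    Summable.of_nonneg_of_le (fun n => mul_nonneg (norm_nonneg _) (absSum_nonneg _ h0))
      (fun n => mul_le_mul_of_nonneg_left (hpow n) (norm_nonneg _)) (summable_norm_coeff hs h0 h1)
  have hprod : Summable fun p : ℕ × ℕ => ‖a p.1 p.2‖ * r ^ p.2 := by
    refine (summable_prod_of_nonneg fun p => by positivity).2 ⟨fun n => (hrow n).summable, ?_⟩
    exact hrows.congr fun n => (hrow n).tsum_eq.symm
  have hcol : ∀ m, Summable fun n => a n m := fun m => by
    have h := hprod.prod_symm.prod_factor m
    simp only [Prod.swap_prod_mk] at h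
    refine Summable.of_norm ?_
    exact (summable_mul_right_iff (pow_ne_zero m hpos.ne')).1 h
  have hcoeff : coeff (fun z => s (ω z)) = fun m => ∑' n, a n m := by
    -- The double series is dominated only for `|z| < r`, which is enough to identify coefficients;
    -- this uses `r > 0`.
    refine coeff_eq_of_hasSum hpos (analyticAt_zero (hs.comp hω hωd)) fun z hz => ?_
    have hz1 : ‖z‖ < 1 := hz.trans h1
    have hsz : Summable fun p : ℕ × ℕ => a p.1 p.2 * z ^ p.2 := by
      refine Summable.of_norm_bounded hprod fun p => ?_
      rw [norm_mul, norm_pow]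
      gcongr
    have hin : ∀ n, HasSum (fun m => a n m * z ^ m) (coeff s n * ω z ^ n) := fun n => by
      refine ((hasSum_coeff (hω.fun_pow n) hz1).mul_left (coeff s n)).congr_fun' fun m => ?_
      rw [ha]
      ring
    have htot : ∑' p : ℕ × ℕ, a p.1 p.2 * z ^ p.2 = s (ω z) :=
      (hsz.hasSum.prod_fiberwise hin).unique
        (hasSum_coeff hs (mem_disk.1 (hωd (mem_disk.2 hz1))))
    have hsw : HasSum (fun p : ℕ × ℕ => a p.2 p.1 * z ^ p.1) (s (ω z)) := by
      rw [← htot]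
      exact (Equiv.prodComm ℕ ℕ).hasSum_iff.2 hsz.hasSum
    exact hsw.prod_fiberwise fun m => (hcol m).hasSum.mul_right (z ^ m)
  have hsum2 : ∑' m, ∑' n, ‖a n m‖ * r ^ m = ∑' n, ∑' m, ‖a n m‖ * r ^ m :=
    (Summable.tsum_comm (f := fun m n => ‖a n m‖ * r ^ m) hprod.prod_symm).symm
  calc absSum (fun z => s (ω z)) r ≤ ∑' m, ∑' n, ‖a n m‖ * r ^ m := by
        refine Summable.tsum_le_tsum (fun m => ?_)
          (summable_norm_coeff (hs.comp hω hωd) h0 h1) hprod.prod_symm.prod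
        rw [hcoeff, tsum_mul_right]
        exact mul_le_mul_of_nonneg_right (norm_tsum_le_tsum_norm (hcol m).norm) (by positivity)
    _ = ∑' n, ‖coeff s n‖ * absSum (fun z => ω z ^ n) r := by
        rw [hsum2]
        exact tsum_congr fun n => (hrow n).tsum_eq
    _ ≤ absSum s r := Summable.tsum_le_tsum
        (fun n => mul_le_mul_of_nonneg_left (hpow n) (norm_nonneg _)) hrows
        (summable_norm_coeff hs h0 h1)

theorem absSum_id_mul {χ : ℂ → ℂ} (hχ : DifferentiableOn ℂ χ disk) {r : ℝ} (h0 : 0 ≤ r)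
    (h1 : r < 1) : absSum (fun z => z * χ z) r = r * absSum χ r := by
  have hd : DifferentiableOn ℂ (fun z => z * χ z) disk :=
    (differentiableOn_id (𝕜 := ℂ)).fun_mul hχ
  have hc : coeff (fun z => z * χ z) = fun n => if n = 0 then 0 else coeff χ (n - 1) := by
    refine coeff_eq_of_hasSum one_pos (analyticAt_zero hd) fun z hz => ?_
    rw [← hasSum_nat_add_iff' 1]
    simp only [Finset.range_one, Finset.sum_singleton, if_true, zero_mul, sub_zero,
      Nat.add_eq_zero_iff, one_ne_zero, and_false, if_false, Nat.add_sub_cancel]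
    refine ((hasSum_coeff hχ hz).mul_left z).congr_fun' fun n => ?_
    rw [pow_succ]
    ring
  rw [absSum, (summable_norm_coeff hd h0 h1).tsum_eq_zero_add, hc, absSum, ← tsum_mul_left]
  simp only [if_true, norm_zero, zero_mul, zero_add,
      Nat.add_eq_zero_iff, one_ne_zero, and_false, if_false, Nat.add_sub_cancel]
  refine tsum_congr fun n => ?_
  rw [pow_succ]
  ring

/-- **Bohr's theorem**. -/
theorem absSum_le_one {χ : ℂ → ℂ} (hχ : DifferentiableOn ℂ χ disk)
    (hb : ∀ z ∈ disk, ‖χ z‖ ≤ 1) {r : ℝ} (h0 : 0 ≤ r) (h1 : r ≤ 1 / 3) : absSum χ r ≤ 1 := by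
  have hr1 : r < 1 := by linarith
  have hs := summable_norm_coeff hχ h0 hr1
  have hc0 : ‖coeff χ 0‖ ≤ 1 := by rw [coeff_zero]; exact hb 0 zero_mem_disk
  have hgeo : HasSum (fun n : ℕ => 2 * (1 - ‖coeff χ 0‖) * r * r ^ n)
      (2 * (1 - ‖coeff χ 0‖) * r * (1 - r)⁻¹) := (hasSum_geometric_of_lt_one h0 hr1).mul_left _
  have htail : ∑' n, ‖coeff χ (n + 1)‖ * r ^ (n + 1)
      ≤ 2 * (1 - ‖coeff χ 0‖) * r * (1 - r)⁻¹ := by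
    rw [← hgeo.tsum_eq]
    refine Summable.tsum_le_tsum (fun n => ?_) ((summable_nat_add_iff 1).2 hs) hgeo.summable
    have := mul_le_mul_of_nonneg_right (norm_coeff_le hχ hb n.succ_ne_zero)
      (pow_nonneg h0 (n + 1))
    refine this.trans_eq ?_
    rw [pow_succ]
    ring
  -- The origin of `1/3`: here `r/(1 - r) ≤ 1/2`, so the tail is at most `1 - ‖coeff χ 0‖`.
  have hq : r * (1 - r)⁻¹ ≤ 1 / 2 := by
    rw [← div_eq_mul_inv, div_le_iff₀ (by linarith)]
    linarith
  rw [absSum, hs.tsum_eq_zero_add, pow_zero, mul_one]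
  nlinarith

/-- By Schwarz's lemma `ω(z)/z` is bounded by `1`, so Bohr's theorem applies to it. -/
theorem absSum_schwarz_le {ω : ℂ → ℂ} (hω : DifferentiableOn ℂ ω disk) (hωd : MapsTo ω disk disk)
    (hω0 : ω 0 = 0) {r : ℝ} (h0 : 0 ≤ r) (h1 : r ≤ 1 / 3) : absSum ω r ≤ r := by
  have hd : DifferentiableOn ℂ (dslope ω 0) disk :=
    (Complex.differentiableOn_dslope (disk_mem_nhds zero_mem_disk)).2 hω
  have hb : ∀ z ∈ disk, ‖dslope ω 0 z‖ ≤ 1 := fun z hz => by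
    have := Complex.norm_dslope_le_div_of_mapsTo_ball (R₂ := 1) hω
      (by rw [hω0]; exact hωd.mono_right Metric.ball_subset_closedBall) hz
    simpa using this
  have heq : EqOn ω (fun z => z * dslope ω 0 z) disk := fun z _ => by
    simpa [hω0] using (sub_smul_dslope ω 0 z).symm
  rw [absSum_congr heq, absSum_id_mul hd h0 (by linarith)]
  exact mul_le_of_le_one_right h0 (absSum_le_one hd hb h0 h1)

open scoped ComplexOrder

/-! ### Comparison of majorant series -/

theorem hasDerivAt_absSum {g : ℂ → ℂ} (hg : DifferentiableOn ℂ g disk) {t : ℝ} (ht : |t| < 1) :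
    HasDerivAt (absSum g) (absSum (deriv g) t) t := by
  obtain ⟨ρ, htρ, hρ⟩ := exists_between ht
  have hρ0 : 0 ≤ ρ := (abs_nonneg t).trans htρ.le
  have hnorm : ∀ n, ‖coeff (deriv g) n‖ = ‖coeff g (n + 1)‖ * (n + 1 : ℕ) := fun n => by
    rw [coeff_deriv, norm_mul, mul_comm]
    congr 1
    exact_mod_cast Complex.norm_natCast (n + 1)
  have hu : Summable fun n : ℕ => ‖coeff g n‖ * (n * ρ ^ (n - 1)) := by
    rw [← summable_nat_add_iff 1]
    refine (summable_norm_coeff (differentiableOn_deriv hg) hρ0 hρ).congr fun n => ?_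
    rw [hnorm, Nat.add_sub_cancel]
    ring
  have hbd : ∀ n : ℕ, ∀ y ∈ Ioo (-ρ) ρ, ‖‖coeff g n‖ * (n * y ^ (n - 1))‖
      ≤ ‖coeff g n‖ * (n * ρ ^ (n - 1)) := fun n y hy => by
    have hy' : |y| ≤ ρ := abs_le.2 ⟨hy.1.le, hy.2.le⟩
    rw [norm_mul, norm_mul, norm_pow, norm_norm, Real.norm_natCast, Real.norm_eq_abs]
    gcongr
  have ht' : t ∈ Ioo (-ρ) ρ := abs_lt.1 htρ
  have h := hasDerivAt_tsum_of_isPreconnected (g := fun n y => ‖coeff g n‖ * y ^ n)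
    (g' := fun n y => ‖coeff g n‖ * (n * y ^ (n - 1))) (y₀ := 0) (y := t) hu isOpen_Ioo
    isPreconnected_Ioo (fun n y _ => (hasDerivAt_pow n y).const_mul _) hbd
    (by
      have := (abs_nonneg t).trans_lt htρ
      exact ⟨by linarith, this⟩)
    (by simpa using summable_norm_coeff hg le_rfl zero_lt_one) ht'
  refine h.congr_deriv ?_
  rw [(Summable.of_norm_bounded hu fun n => hbd n t ht').tsum_eq_zero_add, absSum]
  simp only [Nat.cast_zero, zero_mul, mul_zero, zero_add, Nat.add_sub_cancel]
  refine tsum_congr fun n => ?_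
  rw [hnorm]
  ring

theorem ofReal_absSum {g : ℂ → ℂ} (hg : DifferentiableOn ℂ g disk) (hn : ∀ n, 0 ≤ coeff g n)
    {t : ℝ} (h0 : 0 ≤ t) (h1 : t < 1) : (absSum g t : ℂ) = g t := by
  rw [absSum, Complex.ofReal_tsum,
    ← (hasSum_coeff hg (z := (t : ℂ)) (by simpa [abs_of_nonneg h0] using h1)).tsum_eq]
  refine tsum_congr fun n => ?_
  push_cast
  rw [Complex.eq_coe_norm_of_nonneg (hn n)]
  simp

/-- Comparing coefficients expresses `n` times the `n`-th one as a convolution with those of `s`; as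
`coeff s 0 = 0`, only lower orders enter. -/
theorem coeff_deriv_nonneg {k s : ℂ → ℂ} (hk : DifferentiableOn ℂ k disk)
    (hs : DifferentiableOn ℂ s disk) (hks : ∀ z ∈ disk, z * deriv (deriv k) z = s z * deriv k z)
    (hk1 : deriv k 0 = 1) (hs0 : coeff s 0 = 0) (hsn : ∀ n, 0 ≤ coeff s n) (n : ℕ) :
    0 ≤ coeff (deriv k) n := by
  have hk' := differentiableOn_deriv hk
  induction n using Nat.strong_induction_on with
  | _ n ih =>
    rcases Nat.eq_zero_or_pos n with rfl | hpos
    · rw [coeff_zero, hk1]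
      exact zero_le_one
    · have h := coeff_id_mul_deriv hk' n
      rw [coeff_congr hks, coeff_mul hs hk'] at h
      have hsum : 0 ≤ ∑ p ∈ Finset.HasAntidiagonal.antidiagonal n,
          coeff s p.1 * coeff (deriv k) p.2 := by
        refine Finset.sum_nonneg fun p hp => ?_
        rw [Finset.HasAntidiagonal.mem_antidiagonal] at hp
        rcases Nat.eq_zero_or_pos p.1 with h0 | h0
        · rw [h0, hs0, zero_mul]
        · exact mul_nonneg (hsn _) (ih _ (by omega))
      have hn : (n : ℂ) ≠ 0 := Nat.cast_ne_zero.2 hpos.ne'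
      rw [h] at hsum
      have := mul_nonneg (show (0 : ℂ) ≤ ((n : ℝ)⁻¹ : ℝ) from
        Complex.zero_le_real.2 (by positivity)) hsum
      rwa [Complex.ofReal_inv, Complex.ofReal_natCast, inv_mul_cancel_left₀ hn] at this

theorem norm_zero_le_absSum {g : ℂ → ℂ} (hg : DifferentiableOn ℂ g disk) {t : ℝ} (h0 : 0 ≤ t)
    (h1 : t < 1) : ‖g 0‖ ≤ absSum g t := by
  simpa [coeff_zero, absSum] using (summable_norm_coeff hg h0 h1).le_tsum 0 fun n _ => by positivity

/-- The quotient `M_{f'}/M_{k'}` is `1` at the origin and does not increase: `t M_{f''} ≤ M_ψ M_{f'}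
≤ M_s M_{f'}`, whereas nonnegative coefficients give the equality `t M_{k''} = M_s M_{k'}`. -/
theorem absSum_deriv_le {f k ψ s : ℂ → ℂ} (hf : DifferentiableOn ℂ f disk)
    (hk : DifferentiableOn ℂ k disk) (hψ : DifferentiableOn ℂ ψ disk)
    (hs : DifferentiableOn ℂ s disk) (hf1 : deriv f 0 = 1) (hk1 : deriv k 0 = 1)
    (hfψ : ∀ z ∈ disk, z * deriv (deriv f) z = ψ z * deriv f z)
    (hks : ∀ z ∈ disk, z * deriv (deriv k) z = s z * deriv k z)
    (hs0 : coeff s 0 = 0) (hsn : ∀ n, 0 ≤ coeff s n) {r : ℝ} (hr : r < 1)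
    (hle : ∀ t ∈ Icc 0 r, absSum ψ t ≤ absSum s t) {t : ℝ} (ht : t ∈ Icc 0 r) :
    absSum (deriv f) t ≤ absSum (deriv k) t := by
  have hf' := differentiableOn_deriv hf
  have hk' := differentiableOn_deriv hk
  have hkn := coeff_deriv_nonneg hk hs hks hk1 hs0 hsn
  have habs : ∀ t ∈ Icc 0 r, |t| < 1 := fun t ht => by
    rw [abs_of_nonneg ht.1]; exact ht.2.trans_lt hr
  have hpos : ∀ t ∈ Icc 0 r, 0 < absSum (deriv k) t := fun t ht =>
    zero_lt_one.trans_le (by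
      simpa [hk1] using norm_zero_le_absSum hk' ht.1 (ht.2.trans_lt hr))
  have hder : ∀ t ∈ Icc 0 r, HasDerivAt (fun t => absSum (deriv f) t / absSum (deriv k) t) _ t :=
    fun t ht => (hasDerivAt_absSum hf' (habs t ht)).div (hasDerivAt_absSum hk' (habs t ht))
      (hpos t ht).ne'
  have hanti : AntitoneOn (fun t => absSum (deriv f) t / absSum (deriv k) t) (Icc 0 r) := by
    refine antitoneOn_of_deriv_nonpos (convex_Icc 0 r)
      (fun t ht => (hder t ht).continuousAt.continuousWithinAt)
      (fun t ht => (hder t (interior_subset ht)).differentiableAt.differentiableWithinAt)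
      fun t ht => ?_
    have htI := interior_subset ht
    rw [interior_Icc] at ht
    have ht1 : t < 1 := ht.2.trans hr
    rw [(hder t htI).deriv]
    refine div_nonpos_of_nonpos_of_nonneg ?_ (sq_nonneg _)
    have e1 : t * absSum (deriv (deriv f)) t ≤ absSum s t * absSum (deriv f) t := by
      rw [← absSum_id_mul (differentiableOn_deriv hf') ht.1.le ht1, absSum_congr hfψ]
      exact (absSum_mul_le hψ hf' ht.1.le ht1).trans
        (mul_le_mul_of_nonneg_right (hle t htI) (absSum_nonneg _ ht.1.le))
    have e2 : t * absSum (deriv (deriv k)) t = absSum s t * absSum (deriv k) t := by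
      rw [← absSum_id_mul (differentiableOn_deriv hk') ht.1.le ht1, absSum_congr hks]
      have hc : ∀ n, 0 ≤ coeff (fun z => s z * deriv k z) n := fun n => by
        rw [coeff_mul hs hk']
        exact Finset.sum_nonneg fun p _ => mul_nonneg (hsn _) (hkn _)
      have := ofReal_absSum (hs.fun_mul hk') hc ht.1.le ht1
      rw [← ofReal_absSum hs hsn ht.1.le ht1, ← ofReal_absSum hk' hkn ht.1.le ht1] at this
      exact_mod_cast this
    have e3 : t * (absSum (deriv (deriv f)) t * absSum (deriv k) t -
        absSum (deriv f) t * absSum (deriv (deriv k)) t) ≤ 0 := by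
      have := mul_le_mul_of_nonneg_right e1 (hpos t htI).le
      have h4 : absSum (deriv f) t * (t * absSum (deriv (deriv k)) t)
          = absSum (deriv f) t * (absSum s t * absSum (deriv k) t) := by rw [e2]
      nlinarith
    exact nonpos_of_mul_nonpos_right e3 ht.1
  have h := hanti ⟨le_rfl, ht.1.trans ht.2⟩ ht ht.1
  simp only [absSum_zero, hf1, hk1, norm_one, div_one] at h
  exact (div_le_one (hpos t ht)).1 h

theorem absSum_le_of_absSum_deriv_le {f k : ℂ → ℂ} (hf : DifferentiableOn ℂ f disk)
    (hk : DifferentiableOn ℂ k disk) (h0 : ‖f 0‖ ≤ ‖k 0‖) {r : ℝ} (hr0 : 0 ≤ r) (hr : r < 1)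
    (hle : ∀ t ∈ Icc 0 r, absSum (deriv f) t ≤ absSum (deriv k) t) :
    absSum f r ≤ absSum k r := by
  have hder : ∀ t ∈ Icc 0 r, HasDerivAt (fun t => absSum k t - absSum f t)
      (absSum (deriv k) t - absSum (deriv f) t) t := fun t ht => by
    have ht1 : |t| < 1 := by rw [abs_of_nonneg ht.1]; exact ht.2.trans_lt hr
    exact (hasDerivAt_absSum hk ht1).sub (hasDerivAt_absSum hf ht1)
  have hmono : MonotoneOn (fun t => absSum k t - absSum f t) (Icc 0 r) := by
    refine monotoneOn_of_deriv_nonneg (convex_Icc 0 r)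
      (fun t ht => (hder t ht).continuousAt.continuousWithinAt)
      (fun t ht => (hder t (interior_subset ht)).differentiableAt.differentiableWithinAt)
      fun t ht => ?_
    rw [(hder t (interior_subset ht)).deriv, sub_nonneg]
    exact hle t (interior_subset ht)
  have h := hmono (left_mem_Icc.2 hr0) (right_mem_Icc.2 hr0) hr0
  simp only [absSum_zero] at h
  linarith

theorem majorant_eq_absSum {f : ℂ → ℂ} (hf : IsUnivalentNormalized f) {r : ℝ} (h0 : 0 ≤ r)
    (h1 : r < 1) : majorant f r = absSum f r := by
  rw [majorant, absSum, ← (summable_norm_coeff hf.analytic h0 h1).sum_add_tsum_nat_add 2]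
  simp [Finset.sum_range_succ, coeff_zero, coeff_one, hf.map_zero, hf.deriv_zero]

open scoped ComplexOrder

/-! ### The Ma–Minda function minus one -/

theorem mul_deriv_deriv_eq {f ψ Q : ℂ → ℂ} (hQ : DifferentiableOn ℂ Q disk)
    (hQψ : ∀ z ∈ disk, z * deriv Q z = ψ z)
    (hfQ : ∀ z ∈ disk, deriv f z = Complex.exp (Q z)) :
    ∀ z ∈ disk, z * deriv (deriv f) z = ψ z * deriv f z := fun z hz => by
  have : deriv f =ᶠ[𝓝 z] fun z => Complex.exp (Q z) := by
    filter_upwards [disk_mem_nhds hz] with w hw using hfQ w hw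
  rw [this.deriv_eq, (hasDerivAt_of_mem_disk hQ hz).cexp.deriv, hfQ z hz, ← hQψ z hz]
  ring

theorem ofReal_mem_disk {t : ℝ} (ht : t ∈ Ioo (-1 : ℝ) 1) : (t : ℂ) ∈ disk := by
  rw [mem_disk, Complex.norm_real, Real.norm_eq_abs]
  exact abs_lt.2 ht

theorem hasDerivAt_re_ofReal {g : ℂ → ℂ} (hg : DifferentiableOn ℂ g disk) {t : ℝ}
    (ht : t ∈ Ioo (-1 : ℝ) 1) : HasDerivAt (fun t : ℝ => (g t).re) (deriv g t).re t :=
  (hasDerivAt_of_mem_disk hg (ofReal_mem_disk ht)).real_of_complex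

/-- On the real axis `s` is real, continuous and injective, hence strictly monotone; the sign of
`s'(0)` excludes a decreasing function. -/
theorem strictMonoOn_re_ofReal {s : ℂ → ℂ} (hs : DifferentiableOn ℂ s disk)
    (hinj : InjOn s disk) (hreal : ∀ n, (coeff s n).im = 0) (hd : 0 < (deriv s 0).re) :
    StrictMonoOn (fun t : ℝ => (s t).re) (Ioo (-1) 1) := by
  have hcont : ContinuousOn (fun t : ℝ => (s t).re) (Ioo (-1) 1) := fun t ht =>
    (hasDerivAt_re_ofReal hs ht).continuousAt.continuousWithinAt
  have hinj' : InjOn (fun t : ℝ => (s t).re) (Ioo (-1) 1) := fun a ha b hb hab => by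
    have ha0 := im_eq_zero_of_real_coeff hs hreal (abs_lt.2 ha)
    have hb0 := im_eq_zero_of_real_coeff hs hreal (abs_lt.2 hb)
    exact Complex.ofReal_injective (hinj (ofReal_mem_disk ha) (ofReal_mem_disk hb)
      (Complex.ext hab (ha0.trans hb0.symm)))
  refine (hcont.strictMonoOn_of_injOn_Ioo (by norm_num) hinj').resolve_right fun hanti => ?_
  have h0 : (0 : ℝ) ∈ Ioo (-1 : ℝ) 1 := by norm_num
  have h := hasDerivAt_re_ofReal hs h0
  rw [Complex.ofReal_zero] at h
  refine not_forall_le_of_hasDerivAt_pos (a := -1) (by norm_num) h hd fun t ht => ?_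
  exact (hanti ⟨ht.1, ht.2.trans zero_lt_one⟩ h0 ht.2).le

/-- The data carried by `φ - 1` for a Ma–Minda function `φ` with positive coefficients. -/
structure IsStarGenerator (s : ℂ → ℂ) : Prop where
  analytic : DifferentiableOn ℂ s disk
  univalent : InjOn s disk
  coeff_zero : coeff s 0 = 0
  coeff_nonneg : ∀ n, 0 ≤ coeff s n
  deriv_pos : 0 < (deriv s 0).re

theorem IsMaMinda.isStarGenerator {φ : ℂ → ℂ} (hφ : IsMaMinda φ)
    (hB : ∀ n : ℕ, 1 ≤ n → (coeff φ n).im = 0 ∧ 0 < (coeff φ n).re) :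
    IsStarGenerator fun z => φ z - 1 := by
  have hder : deriv (fun z => φ z - 1) = deriv φ := by
    ext z; rw [deriv_sub_const_fun]
  have h0 : coeff (fun z => φ z - 1) 0 = 0 := by
    rw [MaMinda.coeff_zero, hφ.map_zero, sub_self]
  refine ⟨hφ.analytic.sub_const 1, fun z hz w hw h => hφ.univalent hz hw (sub_left_inj.1 h), h0,
    fun n => ?_, by rw [hder]; exact hφ.deriv_pos⟩
  rcases n with _ | n
  · exact h0.ge
  · have h1 := coeff_deriv (fun z => φ z - 1) n
    rw [hder, coeff_deriv] at h1
    have hn : (n : ℂ) + 1 ≠ 0 := by exact_mod_cast n.succ_ne_zero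
    rw [← mul_left_cancel₀ hn h1, Complex.nonneg_iff]
    have := hB (n + 1) (by omega)
    exact ⟨this.2.le, this.1.symm⟩

namespace IsStarGenerator

variable {s : ℂ → ℂ}

theorem coeff_im (hs : IsStarGenerator s) (n : ℕ) : (coeff s n).im = 0 :=
  (Complex.nonneg_iff.1 (hs.coeff_nonneg n)).2.symm

theorem map_zero (hs : IsStarGenerator s) : s 0 = 0 := by
  rw [← MaMinda.coeff_zero s, hs.coeff_zero]

theorem strictMonoOn (hs : IsStarGenerator s) :
    StrictMonoOn (fun t : ℝ => (s t).re) (Ioo (-1) 1) :=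
  strictMonoOn_re_ofReal hs.analytic hs.univalent hs.coeff_im hs.deriv_pos

end IsStarGenerator

/-! ### The extremal function -/

/-- The derivative of the normalized function `k` is the exponential of an Euler primitive `P` of `s`. -/
structure IsExtremalPair (s k P : ℂ → ℂ) : Prop where
  gen : IsStarGenerator s
  normalized : IsUnivalentNormalized k
  analytic : DifferentiableOn ℂ P disk
  map_zero : P 0 = 0
  mul_deriv : ∀ z ∈ disk, z * deriv P z = s z
  deriv_eq : ∀ z ∈ disk, deriv k z = Complex.exp (P z)

namespace IsExtremalPair

variable {s k P : ℂ → ℂ}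

theorem im_eq_zero (h : IsExtremalPair s k P) {t : ℝ} (ht : |t| < 1) : (P t).im = 0 := by
  refine im_eq_zero_of_real_coeff h.analytic (fun n => ?_) ht
  rcases Nat.eq_zero_or_pos n with rfl | hn
  · rw [coeff_zero, h.map_zero, Complex.zero_im]
  · have h1 := coeff_id_mul_deriv h.analytic n
    rw [coeff_congr h.mul_deriv] at h1
    have h2 := congrArg Complex.im h1
    rw [h.gen.coeff_im, ← Complex.ofReal_natCast, Complex.im_ofReal_mul] at h2
    exact (mul_eq_zero.1 h2.symm).resolve_left (by exact_mod_cast hn.ne')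

/-- For `x < 0` one has `x P'(x) = s(x) < 0`, so `P` increases up to `P(0) = 0`. -/
theorem re_neg (h : IsExtremalPair s k P) {t : ℝ} (ht : t ∈ Ioo (0 : ℝ) 1) :
    (P ((-t : ℝ) : ℂ)).re < 0 := by
  have hIoo : ∀ x ∈ Icc (-t) 0, x ∈ Ioo (-1 : ℝ) 1 := fun x hx =>
    ⟨by linarith [hx.1, ht.2], by linarith [hx.2]⟩
  have hmono : StrictMonoOn (fun x : ℝ => (P x).re) (Icc (-t) 0) := by
    refine strictMonoOn_of_deriv_pos (convex_Icc _ _) (fun x hx =>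
      (hasDerivAt_re_ofReal h.analytic (hIoo x hx)).continuousAt.continuousWithinAt) fun x hx => ?_
    have hx' := hIoo x (interior_subset hx)
    rw [interior_Icc] at hx
    rw [(hasDerivAt_re_ofReal h.analytic hx').deriv]
    have h1 := congrArg Complex.re (h.mul_deriv x (ofReal_mem_disk hx'))
    rw [Complex.re_ofReal_mul] at h1
    have h2 := h.gen.strictMonoOn hx' (by norm_num : (0 : ℝ) ∈ Ioo (-1 : ℝ) 1) hx.2
    simp only [Complex.ofReal_zero, h.gen.map_zero, Complex.zero_re] at h2
    rw [← h1] at h2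
    by_contra! hcon
    exact h2.not_ge (mul_nonneg_of_nonpos_of_nonpos hx.2.le hcon)
  have := hmono ⟨le_rfl, by linarith [ht.1]⟩ ⟨by linarith [ht.1], le_rfl⟩
    (by linarith [ht.1] : -t < 0)
  simpa [h.map_zero] using this

theorem coeff_deriv_nonneg (h : IsExtremalPair s k P) (n : ℕ) : 0 ≤ coeff (deriv k) n :=
  MaMinda.coeff_deriv_nonneg h.normalized.analytic h.gen.analytic
    (mul_deriv_deriv_eq h.analytic h.mul_deriv h.deriv_eq) h.normalized.deriv_zero
    h.gen.coeff_zero h.gen.coeff_nonneg n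

theorem coeff_nonneg (h : IsExtremalPair s k P) (n : ℕ) : 0 ≤ coeff k n := by
  rcases n with _ | n
  · rw [coeff_zero, h.normalized.map_zero]
  · have h1 := h.coeff_deriv_nonneg n
    rw [coeff_deriv] at h1
    have hn : (n : ℂ) + 1 ≠ 0 := by exact_mod_cast n.succ_ne_zero
    have := mul_nonneg (show (0 : ℂ) ≤ (((n : ℝ) + 1)⁻¹ : ℝ) from
      Complex.zero_le_real.2 (by positivity)) h1
    push_cast at this
    rwa [inv_mul_cancel_left₀ hn] at this

theorem apply_ofReal (h : IsExtremalPair s k P) {t : ℝ} (h0 : 0 ≤ t) (h1 : t < 1) :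
    k t = (absSum k t : ℂ) :=
  (ofReal_absSum h.normalized.analytic h.coeff_nonneg h0 h1).symm

theorem le_absSum (h : IsExtremalPair s k P) {t : ℝ} (h0 : 0 ≤ t) (h1 : t < 1) :
    t ≤ absSum k t := by
  simpa [coeff_one, h.normalized.deriv_zero, absSum] using
    (summable_norm_coeff h.normalized.analytic h0 h1).le_tsum 1 fun n _ => by positivity

theorem strictMonoOn_absSum (h : IsExtremalPair s k P) : StrictMonoOn (absSum k) (Ico 0 1) := by
  have habs : ∀ t ∈ Ico (0 : ℝ) 1, |t| < 1 := fun t ht => by rw [abs_of_nonneg ht.1]; exact ht.2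
  refine strictMonoOn_of_deriv_pos (convex_Ico 0 1) (fun t ht =>
    (hasDerivAt_absSum h.normalized.analytic (habs t ht)).continuousAt.continuousWithinAt)
    fun t ht => ?_
  have ht' := interior_subset ht
  rw [(hasDerivAt_absSum h.normalized.analytic (habs t ht')).deriv]
  refine zero_lt_one.trans_le ?_
  simpa [h.normalized.deriv_zero] using
    norm_zero_le_absSum (differentiableOn_deriv h.normalized.analytic) ht'.1 ht'.2

/-- The lower growth function `t ↦ -k(-t)`. -/
noncomputable def growth (k : ℂ → ℂ) (t : ℝ) : ℝ := -(k ((-t : ℝ) : ℂ)).re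

/-- The number `-k(-1)`. -/
noncomputable def koebe (k : ℂ → ℂ) : ℝ := sSup (growth k '' Ioo 0 1)

theorem apply_neg (h : IsExtremalPair s k P) {t : ℝ} (ht : t ∈ Ioo (-1 : ℝ) 1) :
    k (-(t : ℂ)) = -(growth k t : ℂ) := by
  have := im_eq_zero_of_real_coeff h.normalized.analytic
    (fun n => (Complex.nonneg_iff.1 (h.coeff_nonneg n)).2.symm) (t := -t)
    (by rw [abs_neg]; exact abs_lt.2 ht)
  rw [growth, Complex.ofReal_neg, neg_neg, ← Complex.ofReal_neg]
  exact Complex.ext (by simp) (by simpa using this)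

theorem growth_zero (h : IsExtremalPair s k P) : growth k 0 = 0 := by
  simp [growth, h.normalized.map_zero]

theorem hasDerivAt_growth (h : IsExtremalPair s k P) {t : ℝ} (ht : t ∈ Ioo (-1 : ℝ) 1) :
    HasDerivAt (growth k) (Real.exp (P (-(t : ℂ))).re) t := by
  have ht' : -t ∈ Ioo (-1 : ℝ) 1 := ⟨by linarith [ht.2], by linarith [ht.1]⟩
  have h1 := ((hasDerivAt_re_ofReal h.normalized.analytic ht').comp t (hasDerivAt_neg t)).neg
  refine h1.congr_deriv ?_
  have him : (P ((-t : ℝ) : ℂ)).im = 0 := h.im_eq_zero (abs_lt.2 ht')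
  rw [h.deriv_eq _ (ofReal_mem_disk ht'), Complex.exp_re, him, Real.cos_zero]
  simp

theorem Ico_subset : Ico (0 : ℝ) 1 ⊆ Ioo (-1) 1 := fun _ ht => ⟨by linarith [ht.1], ht.2⟩

theorem strictMonoOn_growth (h : IsExtremalPair s k P) : StrictMonoOn (growth k) (Ico 0 1) :=
  strictMonoOn_of_deriv_pos (convex_Ico 0 1)
    (fun t ht => (h.hasDerivAt_growth (Ico_subset ht)).continuousAt.continuousWithinAt)
    fun t ht => by
      rw [(h.hasDerivAt_growth (Ico_subset (interior_subset ht))).deriv]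
      exact Real.exp_pos _

theorem strictMonoOn_sub_growth (h : IsExtremalPair s k P) :
    StrictMonoOn (fun t => t - growth k t) (Ico 0 1) := by
  have hd : ∀ t ∈ Ico (0 : ℝ) 1, HasDerivAt (fun t => t - growth k t)
      (1 - Real.exp (P (-(t : ℂ))).re) t := fun t ht =>
    (hasDerivAt_id t).sub (h.hasDerivAt_growth (Ico_subset ht))
  refine strictMonoOn_of_deriv_pos (convex_Ico 0 1)
    (fun t ht => (hd t ht).continuousAt.continuousWithinAt) fun t ht => ?_
  rw [(hd t (interior_subset ht)).deriv, sub_pos, Real.exp_lt_one_iff]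
  rw [interior_Ico] at ht
  simpa using h.re_neg ht

theorem half_mem : (1 / 2 : ℝ) ∈ Ico (0 : ℝ) 1 := by norm_num

/-- The gap `t - growth k t` increases, so its positive value at `1/2` (any interior point would do)
persists up to `1`. This makes the supremum finite and strictly less than `1`. -/
theorem growth_le (h : IsExtremalPair s k P) {t : ℝ} (ht : t ∈ Ioo (0 : ℝ) 1) :
    growth k t ≤ 1 - (1 / 2 - growth k (1 / 2)) := by
  have ht' := Ioo_subset_Ico_self ht
  rcases le_total t (1 / 2) with hle | hle
  · have := h.strictMonoOn_growth.monotoneOn ht' half_mem hle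
    linarith
  · have := h.strictMonoOn_sub_growth.monotoneOn half_mem ht' hle
    linarith [ht.2]

theorem bddAbove_growth (h : IsExtremalPair s k P) : BddAbove (growth k '' Ioo 0 1) :=
  ⟨1 - (1 / 2 - growth k (1 / 2)), by
    rintro _ ⟨t, ht, rfl⟩
    exact h.growth_le ht⟩

theorem tendsto_growth (h : IsExtremalPair s k P) :
    Tendsto (growth k) (𝓝[<] 1) (𝓝 (koebe k)) :=
  (h.strictMonoOn_growth.monotoneOn.mono Ioo_subset_Ico_self).tendsto_nhdsWithin_Ioo_left
    (nonempty_Ioo.2 zero_lt_one) h.bddAbove_growth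

theorem koebe_le {x : ℝ} (hx : ∀ t ∈ Ioo (0 : ℝ) 1, growth k t ≤ x) : koebe k ≤ x :=
  csSup_le ((nonempty_Ioo.2 zero_lt_one).image _) (by rintro _ ⟨t, ht, rfl⟩; exact hx t ht)

theorem koebe_lt_one (h : IsExtremalPair s k P) : koebe k < 1 := by
  have h1 := koebe_le fun t ht => h.growth_le ht
  have h2 := h.strictMonoOn_sub_growth ⟨le_rfl, zero_lt_one⟩ half_mem (by norm_num)
  simp only [h.growth_zero, sub_zero] at h2
  linarith

theorem koebe_pos (h : IsExtremalPair s k P) : 0 < koebe k := by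
  have h1 : growth k (1 / 2) ≤ koebe k :=
    le_csSup h.bddAbove_growth (mem_image_of_mem _ (by norm_num))
  have h2 := h.strictMonoOn_growth ⟨le_rfl, zero_lt_one⟩ half_mem (by norm_num)
  rw [h.growth_zero] at h2
  linarith

theorem tendsto_apply_neg (h : IsExtremalPair s k P) :
    Tendsto (fun r : ℝ => k (-(r : ℂ))) (𝓝[<] 1) (𝓝 ((-koebe k : ℝ) : ℂ)) := by
  have h1 : Tendsto (fun r : ℝ => ((-growth k r : ℝ) : ℂ)) (𝓝[<] 1) (𝓝 ((-koebe k : ℝ) : ℂ)) :=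
    (Complex.continuous_ofReal.tendsto _).comp h.tendsto_growth.neg
  refine h1.congr' ?_
  filter_upwards [Ioo_mem_nhdsLT (zero_lt_one' ℝ)] with r hr
  rw [h.apply_neg (Ico_subset (Ioo_subset_Ico_self hr)), Complex.ofReal_neg]

/-- For `b` between `koebe k` and `1` one has `absSum k b ≥ b > koebe k`, so the value `koebe k` is
taken before `b`. -/
theorem exists_absSum_eq (h : IsExtremalPair s k P) :
    ∃ r ∈ Ioo (0 : ℝ) 1, absSum k r = koebe k := by
  obtain ⟨b, hb1, hb2⟩ := exists_between h.koebe_lt_one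
  have hb0 := h.koebe_pos.trans hb1
  have hcont : ContinuousOn (absSum k) (Icc 0 b) := fun t ht =>
    (hasDerivAt_absSum h.normalized.analytic (by
      rw [abs_of_nonneg ht.1]; exact ht.2.trans_lt hb2)).continuousAt.continuousWithinAt
  have h0 : absSum k 0 = 0 := by rw [absSum_zero, h.normalized.map_zero, norm_zero]
  obtain ⟨r, hr, hrk⟩ := intermediate_value_Ioo hb0.le hcont
    (show koebe k ∈ Ioo (absSum k 0) (absSum k b) from
      ⟨by rw [h0]; exact h.koebe_pos, hb1.trans_le (h.le_absSum hb0.le hb2)⟩)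
  exact ⟨r, ⟨hr.1, hr.2.trans hb2⟩, hrk⟩

end IsExtremalPair

/-! ### The Bohr inequality for the class and its sharpness -/

namespace IsExtremalPair

variable {s k P : ℂ → ℂ}

theorem koebe_le_boundaryDist (h : IsExtremalPair s k P) {f : ℂ → ℂ}
    (hf : IsConvexClass (fun z => 1 + s z) f) : koebe k ≤ boundaryDist f := by
  obtain ⟨hfS, ω, hω, hωd, hω0, hfω⟩ := hf
  obtain ⟨Q, hQ, hQ0, hQs, hfQ⟩ := exists_log_deriv hfS.analytic hfS.deriv_zero
    (ψ := fun z => s (ω z)) (h.gen.analytic.comp hω hωd) (by simp only [hω0, h.gen.map_zero]) hfω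
  have hd : ∀ z ∈ disk, deriv f z ≠ 0 := fun z hz => by
    rw [hfQ z hz]; exact Complex.exp_ne_zero _
  rw [boundaryDist, hfS.map_zero,
    Metric.le_infDist (frontier_image_nonempty hfS.analytic hfS.univalent hd)]
  intro w hw
  rw [dist_zero_left]
  refine koebe_le fun t ht => le_norm_of_mem_frontier_image (K := growth k)
    (K' := fun t => Real.exp (P (-(t : ℂ))).re) hfS.analytic hfS.univalent hfS.map_zero hd
    (fun t ht => h.hasDerivAt_growth (Ico_subset ht)) h.growth_zero (fun t _ => Real.exp_pos _)
    (fun z hz => ?_) hw (Ioo_subset_Ico_self ht)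
  rw [hfQ z hz, Complex.norm_exp]
  exact Real.exp_le_exp.2 (re_log_deriv_ge h.gen.analytic h.gen.univalent h.gen.coeff_im
    h.gen.strictMonoOn.monotoneOn hω hωd hω0 h.analytic h.map_zero h.mul_deriv hQ hQ0 hQs
    (mem_disk.1 hz))

theorem absSum_le (h : IsExtremalPair s k P) {f : ℂ → ℂ}
    (hf : IsConvexClass (fun z => 1 + s z) f) {r : ℝ} (h0 : 0 ≤ r) (h1 : r ≤ 1 / 3) :
    absSum f r ≤ absSum k r := by
  obtain ⟨hfS, ω, hω, hωd, hω0, hfω⟩ := hf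
  have hψ : DifferentiableOn ℂ (fun z => s (ω z)) disk := h.gen.analytic.comp hω hωd
  obtain ⟨Q, hQ, hQ0, hQs, hfQ⟩ := exists_log_deriv hfS.analytic hfS.deriv_zero hψ
    (by simp only [hω0, h.gen.map_zero]) hfω
  have hr : r < 1 := by linarith
  refine absSum_le_of_absSum_deriv_le hfS.analytic h.normalized.analytic
    (by rw [hfS.map_zero, h.normalized.map_zero]) h0 hr fun t ht =>
      absSum_deriv_le hfS.analytic h.normalized.analytic hψ h.gen.analytic hfS.deriv_zero
        h.normalized.deriv_zero (mul_deriv_deriv_eq hQ hQs hfQ)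
        (mul_deriv_deriv_eq h.analytic h.mul_deriv h.deriv_eq) h.gen.coeff_zero
        h.gen.coeff_nonneg hr (fun t ht => ?_) ht
  have ht3 : t ≤ 1 / 3 := ht.2.trans h1
  exact absSum_comp_le h.gen.analytic hω hωd hω0 ht.1 (by linarith)
    (absSum_schwarz_le hω hωd hω0 ht.1 ht3)

end IsExtremalPair

theorem norm_exp_ofReal_mul_I_mul (θ : ℝ) (z : ℂ) :
    ‖Complex.exp (θ * Complex.I) * z‖ = ‖z‖ := by
  rw [norm_mul, Complex.norm_exp_ofReal_mul_I, one_mul]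

theorem mapsTo_rotation_disk (θ : ℝ) :
    MapsTo (fun z => Complex.exp (θ * Complex.I) * z) disk disk := fun z hz => by
  rw [mem_disk, norm_exp_ofReal_mul_I_mul]; exact mem_disk.1 hz

theorem deriv_rotation (θ : ℝ) (k : ℂ → ℂ) :
    deriv (rotation θ k) = fun z => deriv k (Complex.exp (θ * Complex.I) * z) := by
  ext z
  unfold rotation
  rw [deriv_const_mul_field, deriv_comp_mul_left, smul_eq_mul, ← mul_assoc, ← Complex.exp_add,
    neg_add_cancel, Complex.exp_zero, one_mul]

theorem IsUnivalentNormalized.rotation {k : ℂ → ℂ} (hk : IsUnivalentNormalized k) (θ : ℝ) :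
    IsUnivalentNormalized (rotation θ k) := by
  refine ⟨?_, ?_, ?_, ?_⟩
  · exact (hk.analytic.comp (by fun_prop) (mapsTo_rotation_disk θ)).const_mul _
  · simp [MaMinda.rotation, hk.map_zero]
  · simp [deriv_rotation, hk.deriv_zero]
  · intro z hz w hw hzw
    exact mul_left_cancel₀ (Complex.exp_ne_zero _) (hk.univalent (mapsTo_rotation_disk θ hz)
      (mapsTo_rotation_disk θ hw) (mul_left_cancel₀ (Complex.exp_ne_zero _) hzw))

theorem convexityQuotient_rotation (θ : ℝ) (k : ℂ → ℂ) (z : ℂ) :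
    convexityQuotient (rotation θ k) z
      = convexityQuotient k (Complex.exp (θ * Complex.I) * z) := by
  rw [convexityQuotient, convexityQuotient, deriv_rotation, deriv_comp_mul_left, smul_eq_mul]
  ring

theorem IsConvexExtremal.isConvexClass_rotation {φ k : ℂ → ℂ} (hk : IsConvexExtremal φ k)
    (θ : ℝ) : IsConvexClass φ (rotation θ k) := by
  refine ⟨hk.1.rotation θ, fun z => Complex.exp (θ * Complex.I) * z, by fun_prop,
    mapsTo_rotation_disk θ, mul_zero _, fun z hz => ?_⟩
  rw [convexityQuotient_rotation, hk.2 _ (mapsTo_rotation_disk θ hz)]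

theorem absSum_rotation {k : ℂ → ℂ} (hk : IsUnivalentNormalized k) (θ : ℝ) :
    absSum (rotation θ k) = absSum k := by
  have hc : coeff (rotation θ k) = fun n =>
      Complex.exp (-(θ * Complex.I)) * Complex.exp (θ * Complex.I) ^ n * coeff k n := by
    refine coeff_eq_of_hasSum one_pos (analyticAt_zero (hk.rotation θ).analytic) fun z hz => ?_
    refine ((hasSum_coeff hk.analytic (z := Complex.exp (θ * Complex.I) * z)
      (by rwa [norm_exp_ofReal_mul_I_mul])).mul_left (Complex.exp (-(θ * Complex.I)))).congr_fun'
      fun n => ?_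
    rw [mul_pow]
    ring
  ext r
  refine tsum_congr fun n => ?_
  rw [hc, norm_mul, norm_mul, norm_pow, Complex.norm_exp_ofReal_mul_I, ← neg_mul,
    ← Complex.ofReal_neg, Complex.norm_exp_ofReal_mul_I, one_pow, one_mul, one_mul]

namespace IsExtremalPair

variable {s k P : ℂ → ℂ}

/-- Along the radius ending at `-e^{-iθ}` the rotated function tends to `e^{-iθ} k(-1)`, a boundary
point of modulus `koebe k`. -/
theorem boundaryDist_rotation_le (h : IsExtremalPair s k P) (θ : ℝ) :
    boundaryDist (rotation θ k) ≤ koebe k := by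
  have hr := h.normalized.rotation θ
  have hd : ∀ z ∈ disk, deriv (rotation θ k) z ≠ 0 := fun z hz => by
    rw [deriv_rotation]
    simp only [h.deriv_eq _ (mapsTo_rotation_disk θ hz)]
    exact Complex.exp_ne_zero _
  have hn : ∀ r : ℝ, ‖Complex.exp (-(θ * Complex.I)) * -(r : ℂ)‖ = |r| := fun r => by
    rw [← neg_mul, ← Complex.ofReal_neg, norm_exp_ofReal_mul_I_mul, norm_neg, Complex.norm_real,
      Real.norm_eq_abs]
  have hmem := mem_frontier_image_of_tendsto (l := 𝓝[<] (1 : ℝ))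
    (γ := fun r : ℝ => Complex.exp (-(θ * Complex.I)) * -(r : ℂ))
    (w := Complex.exp (-(θ * Complex.I)) * ((-koebe k : ℝ) : ℂ)) hr.analytic hr.univalent hd
    (by
      filter_upwards [Ioo_mem_nhdsLT (zero_lt_one' ℝ)] with r hr
      rw [mem_disk, hn, abs_of_pos hr.1]
      exact hr.2)
    (by
      simp only [hn]
      have : Tendsto (fun r : ℝ => |r|) (𝓝[<] 1) (𝓝 |1|) :=
        (continuous_abs.tendsto 1).mono_left nhdsWithin_le_nhds
      simpa using this)
    (by
      refine (h.tendsto_apply_neg.const_mul (Complex.exp (-(θ * Complex.I)))).congr fun r => ?_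
      rw [rotation, ← mul_assoc, ← Complex.exp_add, add_neg_cancel, Complex.exp_zero, one_mul])
  have hdist := Metric.infDist_le_dist_of_mem (x := (0 : ℂ)) hmem
  rw [boundaryDist, hr.map_zero]
  refine hdist.trans_eq ?_
  rw [dist_zero_left, ← neg_mul, ← Complex.ofReal_neg, norm_exp_ofReal_mul_I_mul,
    Complex.norm_real, norm_neg, Real.norm_of_nonneg h.koebe_pos.le]

end IsExtremalPair

end MaMinda

theorem theorem2p10 (φ : ℂ → ℂ) (hφ : MaMinda.IsMaMinda φ)
    (hB : ∀ n : ℕ, 1 ≤ n → (MaMinda.coeff φ n).im = 0 ∧ 0 < (MaMinda.coeff φ n).re)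
    (hH : MaMinda.IsHardyTwo φ) :
    -- the extremal function exists
    (∃ k : ℂ → ℂ, MaMinda.IsConvexExtremal φ k) ∧
    ∀ k : ℂ → ℂ, MaMinda.IsConvexExtremal φ k →
      -- `κ` is the radial limit `k(-1)` and `rf` the smallest root of `k(r) + k(-1) = 0`
      ∃ κ : ℝ, Tendsto (fun r : ℝ => k (-(r : ℂ))) (𝓝[<] 1) (𝓝 (κ : ℂ)) ∧
      ∃ rf : ℝ, IsLeast {r : ℝ | r ∈ Ioo (0 : ℝ) 1 ∧ k (r : ℂ) + (κ : ℂ) = 0} rf ∧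
        -- the Bohr inequality for the whole class
        (∀ f : ℂ → ℂ, MaMinda.IsConvexClass φ f →
          (∀ z : ℂ, ‖z‖ < 1 → Summable fun n : ℕ => ‖MaMinda.coeff f (n + 2)‖ * ‖z‖ ^ (n + 2)) ∧
          ∀ z : ℂ, ‖z‖ ≤ min rf (1 / 3) →
            MaMinda.majorant f ‖z‖ ≤ MaMinda.boundaryDist f) ∧
        -- sharpness: equality at `rf` and failure beyond `rf` for the rotations of `k`
        (rf ≤ 1 / 3 → ∀ θ : ℝ,
          MaMinda.IsConvexClass φ (MaMinda.rotation θ k) ∧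
          MaMinda.boundaryDist (MaMinda.rotation θ k) = -κ ∧
          MaMinda.majorant (MaMinda.rotation θ k) rf =
            MaMinda.boundaryDist (MaMinda.rotation θ k) ∧
          ∀ z : ℂ, rf < ‖z‖ → ‖z‖ < 1 →
            MaMinda.boundaryDist (MaMinda.rotation θ k) <
              MaMinda.majorant (MaMinda.rotation θ k) ‖z‖) := by
  open MaMinda in
  refine ⟨exists_isConvexExtremal hφ.analytic hφ.re_pos hφ.map_zero, fun k hk => ?_⟩
  have hgen := hφ.isStarGenerator hB
  obtain ⟨P, hP, hP0, hPs, hkP⟩ := exists_log_deriv hk.1.analytic hk.1.deriv_zero hgen.analytic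
    hgen.map_zero (fun z hz => by rw [hk.2 z hz]; ring)
  have h : IsExtremalPair (fun z => φ z - 1) k P := ⟨hgen, hk.1, hP, hP0, hPs, hkP⟩
  have hφs : φ = fun z => 1 + (φ z - 1) := by ext z; ring
  obtain ⟨rf, hrf, hrfk⟩ := h.exists_absSum_eq
  have hmono := h.strictMonoOn_absSum
  refine ⟨-IsExtremalPair.koebe k, h.tendsto_apply_neg, rf, ⟨⟨hrf, ?_⟩, ?_⟩, ?_, ?_⟩
  · rw [h.apply_ofReal hrf.1.le hrf.2, hrfk]
    push_cast
    ring
  · rintro r ⟨hr, hrk⟩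
    rw [h.apply_ofReal hr.1.le hr.2, ← hrfk, ← Complex.ofReal_add, Complex.ofReal_eq_zero] at hrk
    exact (hmono.injOn (Ioo_subset_Ico_self hr) (Ioo_subset_Ico_self hrf)
      (by linarith)).ge
  · intro f hf
    refine ⟨fun z hz => (summable_nat_add_iff 2).2
      (summable_norm_coeff hf.1.analytic (norm_nonneg z) hz), fun z hz => ?_⟩
    have hzr : ‖z‖ ≤ rf := hz.trans (min_le_left _ _)
    have hz3 : ‖z‖ ≤ 1 / 3 := hz.trans (min_le_right _ _)
    have hz1 : ‖z‖ < 1 := hzr.trans_lt hrf.2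
    rw [hφs] at hf
    rw [majorant_eq_absSum hf.1 (norm_nonneg z) hz1]
    -- The chain `M_f(|z|) ≤ M_k(|z|) ≤ M_k(r_f) = -k(-1) ≤ d(f(0), ∂f(𝔻))`.
    exact (h.absSum_le hf (norm_nonneg z) hz3).trans <|
      (hmono.monotoneOn ⟨norm_nonneg z, hz1⟩ (Ioo_subset_Ico_self hrf) hzr).trans <|
      hrfk.trans_le (h.koebe_le_boundaryDist hf)
  · intro _ θ
    have hcl := hk.isConvexClass_rotation θ
    have hcl' := hcl
    rw [hφs] at hcl'
    have hdist : boundaryDist (rotation θ k) = IsExtremalPair.koebe k :=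
      (h.boundaryDist_rotation_le θ).antisymm (h.koebe_le_boundaryDist hcl')
    refine ⟨hcl, by rw [hdist, neg_neg], ?_, fun z hz hz1 => ?_⟩
    · rw [majorant_eq_absSum hcl.1 hrf.1.le hrf.2, absSum_rotation hk.1, hdist, hrfk]
    · rw [majorant_eq_absSum hcl.1 (norm_nonneg z) hz1, absSum_rotation hk.1, hdist, ← hrfk]
      exact hmono (Ioo_subset_Ico_self hrf) ⟨norm_nonneg z, hz1⟩ hz
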